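/- Let $\mathbb F$ be a field, $G=\mathbb Z_2^3$ with neutral element $g_0$ and $$g_1=(\bar1,\bar0,\bar0),\ g_2=(\bar0,\bar1,\bar0),\ g_3=(\bar0,\bar0,\bar1),\ g_4=(\bar1,\bar1,\bar0),\ g_5=(\bar0,\bar1,\bar1),\ g_6=(\bar1,\bar1,\bar1),\ g_7=(\bar1,\bar0,\bar1).$$ For a vector space $V$ and a map $\sigma\colon G\times G\to\mathrm{Bil}(V\times V,V)$, $(g,h)\mapsto\sigma_{g,h}$, the generalized group algebra $V^\sigma[G]$ is the space of formal sums $\sum_{g\in G}r_g g$ ($r_g\in V$) with product $$\Big(\sum_{g} r_g g\Big)\Big(\sum_{h} s_h h\Big)=\sum_{g,h}\sigma_{g,h}(r_g,s_h)(g+h).$$ Let $\sigma$ be the twist on $W=\mathbb F^3$ given, with $\sigma_{i,j}=\sigma_{g_i,g_j}$, indices $1,\dots,7$ modulo $7$, $r=(a_1,a_2,a_3)$ and $s=(b_1,b_2,b_3)$, by $$\begin{aligned}\sigma_{i,i+1}(r,s)&=(-a_2b_1-a_3b_3,\,-a_2b_3-a_3b_1,\,a_1b_2),\\ \sigma_{i,i+2}(r,s)&=(a_2b_3,\,-a_1b_1-a_3b_2,\,-a_1b_2-a_3b_1),\\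 \sigma_{i,i+4}(r,s)&=(-a_1b_2-a_2b_3,\,a_3b_1,\,-a_1b_3-a_2b_2),\end{aligned}$$ $\sigma_{i,i+3}(r,s)=-\sigma_{i,i+4}(s,r)$, $\sigma_{i,i+5}(r,s)=-\sigma_{i,i+2}(s,r)$, $\sigma_{i,i+6}(r,s)=-\sigma_{i,i+1}(s,r)$, and $\sigma_{0,i}=\sigma_{i,0}=\sigma_{0,0}=\sigma_{i,i}=0$. Let $S=\{(a_1,a_2,a_3)\in\mathbb F^3: a_1+a_2+a_3=0\}$. Then $\sigma_{g,h}(S,S)\subseteq S$ for all $g,h\in G$, so the generalized group algebra $S^\sigma[G]$ is defined, and its product is a Lie bracket. If moreover the characteristic of $\mathbb F$ is neither $2$ nor $3$, then the center of $S^\sigma[G]$ is $Sg_0=\{rg_0:r\in S\}$ and has dimension $2$; the set $S^\sigma[G^\times]$ of formal sums whose coefficient at $g_0$ is $0$ is an ideal; $S^\sigma[G]=Sg_0\oplus S^\sigma[G^\times]$; and $S^\sigma[G^\times]$ is a $14$-dimensional simple Lie algebra of type $G_2$, that is, after extension of scalars to an algebraic closure of $\mathbb F$ it is isomorphic to the split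 Lie algebra of type $G_2$ (presented by Serre's generators and relations for the Cartan matrix of type $G_2$). -/

import Mathlib

open scoped TensorProduct

/-- The generalized group algebra `V^σ[G]`: the formal sums `∑ r_g g` with coefficients `r_g` in
the vector space `V`; the twist `σ` assigns to `(g, h)` a bilinear map `V × V → V`. -/
def GenGroupAlg {F G V : Type*} [Field F] [AddCommGroup V] [Module F V]
    (_σ : G → G → V →ₗ[F] V →ₗ[F] V) : Type _ :=
  G →₀ V

namespace GenGroupAlg

section Basic

variable {F G V : Type*} [Field F] [AddCommGroup V] [Module F V]
  (σ : G → G → V →ₗ[F] V →ₗ[F] V)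

noncomputable instance : AddCommGroup (GenGroupAlg σ) :=
  inferInstanceAs (AddCommGroup (G →₀ V))

noncomputable instance : Module F (GenGroupAlg σ) :=
  inferInstanceAs (Module F (G →₀ V))

/-- The coefficient of `g` in a formal sum. -/
def coeff (g : G) : GenGroupAlg σ →ₗ[F] V :=
  Finsupp.lapply (M := V) (R := F) g

/-- The monomial `r g`, linear in the coefficient `r`. -/
noncomputable def mono (g : G) : V →ₗ[F] GenGroupAlg σ :=
  Finsupp.lsingle (M := V) (R := F) g

/-- The subspace `V g` of all monomials `r g`. -/
noncomputable def component (g : G) : Submodule F (GenGroupAlg σ) :=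
  LinearMap.range (mono σ g)

end Basic

section Product

variable {F G V : Type*} [Field F] [AddCommGroup G] [AddCommGroup V] [Module F V]
  (σ : G → G → V →ₗ[F] V →ₗ[F] V)

/-- The product
`(∑ r_g g) * (∑ s_h h) = ∑ σ_{g,h}(r_g, s_h) (g + h)` of formal sums. -/
noncomputable def prod (x y : G →₀ V) : G →₀ V :=
  x.sum fun g r => y.sum fun h s => Finsupp.single (g + h) (σ g h r s)

theorem prod_add_left (x y z : G →₀ V) : prod σ (x + y) z = prod σ x z + prod σ y z := by
  refine Finsupp.sum_add_index' ?_ ?_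
  · intro g
    simp
  · intro g r r'
    simp [Finsupp.sum_add]

theorem prod_add_right (x y z : G →₀ V) : prod σ x (y + z) = prod σ x y + prod σ x z := by
  unfold prod
  rw [← Finsupp.sum_add]
  congr 1
  funext g r
  refine Finsupp.sum_add_index' ?_ ?_
  · intro h
    simp
  · intro h s s'
    simp

theorem prod_smul_right (c : F) (x y : G →₀ V) : prod σ x (c • y) = c • prod σ x y := by
  unfold prod
  rw [Finsupp.smul_sum]
  congr 1
  funext g r
  rw [Finsupp.smul_sum]
  refine (Finsupp.sum_smul_index' ?_).trans ?_
  · intro h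
    simp
  · simp

noncomputable instance : Mul (GenGroupAlg σ) where
  mul x y := prod σ x y

theorem add_mul' (x y z : GenGroupAlg σ) : (x + y) * z = x * z + y * z :=
  prod_add_left σ x y z

theorem mul_add' (x y z : GenGroupAlg σ) : x * (y + z) = x * y + x * z :=
  prod_add_right σ x y z

theorem mul_smul' (c : F) (x y : GenGroupAlg σ) : x * (c • y) = c • (x * y) :=
  prod_smul_right σ c x y

theorem neg_mul' (x y : GenGroupAlg σ) : (-x) * y = -(x * y) := by
  have h0 : (0 : GenGroupAlg σ) * y = 0 := by
    have h := add_mul' σ 0 0 y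
    rwa [add_zero, left_eq_add] at h
  apply eq_neg_of_add_eq_zero_left
  rw [← add_mul', neg_add_cancel, h0]

/-- The product of `V^σ[G]` is a Lie bracket: it is alternating and satisfies the Jacobi
identity. -/
structure IsLie : Prop where
  mul_self : ∀ x : GenGroupAlg σ, x * x = 0
  jacobi : ∀ x y z : GenGroupAlg σ, (x * y) * z + (y * z) * x + (z * x) * y = 0

variable {σ}

theorem IsLie.mul_comm (h : IsLie σ) (x y : GenGroupAlg σ) : x * y = -(y * x) := by
  have := h.mul_self (x + y)
  rw [add_mul', mul_add', mul_add', h.mul_self, h.mul_self, zero_add, add_zero] at this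
  exact eq_neg_of_add_eq_zero_left this

/-- The Lie ring `V^σ[G]`, whose bracket is the product. -/
noncomputable abbrev IsLie.lieRing (h : IsLie σ) : LieRing (GenGroupAlg σ) where
  bracket x y := x * y
  add_lie := add_mul' σ
  lie_add := mul_add' σ
  lie_self := h.mul_self
  leibniz_lie x y z := by
    have hJ := h.jacobi x y z
    change x * (y * z) = (x * y) * z + y * (x * z)
    rw [h.mul_comm x (y * z), h.mul_comm y (x * z), h.mul_comm x z, neg_mul', neg_neg]
    rw [add_right_comm] at hJ
    exact (eq_neg_of_add_eq_zero_left hJ).symm ▸ rfl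

/-- The Lie algebra `V^σ[G]`, whose bracket is the product. -/
noncomputable abbrev IsLie.lieAlgebra (h : IsLie σ) :
    letI := h.lieRing
    LieAlgebra F (GenGroupAlg σ) :=
  letI := h.lieRing
  { (inferInstance : Module F (GenGroupAlg σ)) with
    lie_smul := mul_smul' σ }

end Product

/-- The restriction of a twist to a subspace `S` that is closed under every `σ_{g,h}`. -/
def restrictTwist {F G V : Type*} [Field F] [AddCommGroup V] [Module F V]
    (σ : G → G → V →ₗ[F] V →ₗ[F] V) (S : Submodule F V)
    (hS : ∀ g h : G, ∀ r ∈ S, ∀ s ∈ S, σ g h r s ∈ S) :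
    G → G → S →ₗ[F] S →ₗ[F] S :=
  fun g h => LinearMap.mk₂ F (fun r s => ⟨σ g h r s, hS g h r r.2 s s.2⟩)
    (fun _ _ _ => Subtype.ext (by simp)) (fun _ _ _ => Subtype.ext (by simp))
    (fun _ _ _ => Subtype.ext (by simp)) (fun _ _ _ => Subtype.ext (by simp))

end GenGroupAlg

/-- The group `ℤ₂³`. -/
abbrev Z23 : Type := ZMod 2 × ZMod 2 × ZMod 2

/-- The label in `{1, …, 7}`, taken modulo 7, of a nonzero element of `ℤ₂³`; the neutral element
`g₀` gets `none`. -/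
def label (g : Z23) : Option (Fin 7) :=
  if g = (1, 0, 0) then some 1
  else if g = (0, 1, 0) then some 2
  else if g = (0, 0, 1) then some 3
  else if g = (1, 1, 0) then some 4
  else if g = (0, 1, 1) then some 5
  else if g = (1, 1, 1) then some 6
  else if g = (1, 0, 1) then some 7
  else none

section Twist

variable (F : Type*) [Field F]

/-- The bilinear map `σ_{i,i+1}` on `F³`; the coordinates `a₁, a₂, a₃` are `a 0, a 1, a 2`. -/
def so7Twist₁ : (Fin 3 → F) →ₗ[F] (Fin 3 → F) →ₗ[F] (Fin 3 → F) :=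
  LinearMap.mk₂ F
    (fun a b => ![-a 1 * b 0 - a 2 * b 2, -a 1 * b 2 - a 2 * b 0, a 0 * b 1])
    (fun a a' b => by ext k; fin_cases k <;> simp <;> ring)
    (fun c a b => by ext k; fin_cases k <;> simp <;> ring)
    (fun a b b' => by ext k; fin_cases k <;> simp <;> ring)
    (fun c a b => by ext k; fin_cases k <;> simp <;> ring)

/-- The bilinear map `σ_{i,i+2}` on `F³`. -/
def so7Twist₂ : (Fin 3 → F) →ₗ[F] (Fin 3 → F) →ₗ[F] (Fin 3 → F) :=
  LinearMap.mk₂ F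
    (fun a b => ![a 1 * b 2, -a 0 * b 0 - a 2 * b 1, -a 0 * b 1 - a 2 * b 0])
    (fun a a' b => by ext k; fin_cases k <;> simp <;> ring)
    (fun c a b => by ext k; fin_cases k <;> simp <;> ring)
    (fun a b b' => by ext k; fin_cases k <;> simp <;> ring)
    (fun c a b => by ext k; fin_cases k <;> simp <;> ring)

/-- The bilinear map `σ_{i,i+4}` on `F³`. -/
def so7Twist₄ : (Fin 3 → F) →ₗ[F] (Fin 3 → F) →ₗ[F] (Fin 3 → F) :=
  LinearMap.mk₂ F
    (fun a b => ![-a 0 * b 1 - a 1 * b 2, a 2 * b 0, -a 0 * b 2 - a 1 * b 1])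
    (fun a a' b => by ext k; fin_cases k <;> simp <;> ring)
    (fun c a b => by ext k; fin_cases k <;> simp <;> ring)
    (fun a b b' => by ext k; fin_cases k <;> simp <;> ring)
    (fun c a b => by ext k; fin_cases k <;> simp <;> ring)

/-- The twist `σ` on `ℤ₂³` with values in the bilinear maps on `F³`: it vanishes if one argument is
`g₀` and on the diagonal, and `σ(g_i, g_j)` depends on `j - i` modulo 7. -/
def so7Twist (g h : Z23) : (Fin 3 → F) →ₗ[F] (Fin 3 → F) →ₗ[F] (Fin 3 → F) :=
  match label g, label h with
  | some i, some j =>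
    match j - i with
    | 0 => 0
    | 1 => so7Twist₁ F
    | 2 => so7Twist₂ F
    | 3 => -(so7Twist₄ F).flip
    | 4 => so7Twist₄ F
    | 5 => -(so7Twist₂ F).flip
    | 6 => -(so7Twist₁ F).flip
  | _, _ => 0

/-- The plane `S = {(a₁, a₂, a₃) : a₁ + a₂ + a₃ = 0}` of `F³`. -/
def planeS : Submodule F (Fin 3 → F) where
  carrier := {a | a 0 + a 1 + a 2 = 0}
  zero_mem' := by simp
  add_mem' {a b} ha hb := by
    simp only [Set.mem_ofPred_eq, Pi.add_apply] at *
    linear_combination ha + hb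
  smul_mem' c a ha := by
    simp only [Set.mem_ofPred_eq, Pi.smul_apply, smul_eq_mul] at *
    linear_combination c * ha

end Twist

/-- A Lie algebra over a field `F` (of characteristic other than 2 and 3) is of type `G₂` if, over
an algebraic closure of `F`, it becomes isomorphic to the split Lie algebra of type `G₂`. -/
def IsTypeG2 (F L : Type*) [Field F] [LieRing L] [LieAlgebra F L] : Prop :=
  Nonempty ((AlgebraicClosure F ⊗[F] L) ≃ₗ⁅AlgebraicClosure F⁆
    LieAlgebra.g₂ (AlgebraicClosure F))

/-!
The grading group enters only through the Fano plane: `g_i + g_{i+1} = g_{i+3}` for all `i` modulo 7.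
As `σ` vanishes on `g₀` and on the diagonal, `S^σ[G]` is the direct sum of `S g₀`, which multiplies to
zero with everything, and of `S^σ[G^×]`, and the latter is described by the coordinate model
`G2Model` (`decomposition_mul`), whose bracket is invariant under `i ↦ i + 1`. The Jacobi identity is
a polynomial identity in the coordinates of the model, and the statements on the center and on the
complementary ideal follow once the model is known to be simple.

Simplicity (`G2Model.isSimple`). Every `S g_i` is a Cartan subalgebra. For `h = (0, 1, -1) g_i` the
operator `T = ad(h)²` has the eigenvalues `0`, `-1`, `-4`, and `T (T + 1)` projects to a plane, spanned
by a long root vector in `S g_{i+1}` and one in `S g_{i+3}`. A second operator of this kind removes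
one of the two. So an ideal that contains an element with nonzero component at `g_j` contains a
fixed nonzero vector of `S g_j`; this in turn generates some `S g_k`, and then everything. All
denominators that occur are products of powers of `2` and `3`.

Type `G₂` (`G2Model.isTypeG2_of_equiv`). Over a field that contains a square root of `-1` there are
explicit elements of the model that satisfy Serre's relations (`G2Model.serreRelations`) and generate
it (`G2Model.subalgebra_eq_top`), so that the Lie algebra `g₂` given by Serre's presentation maps onto
the model. Conversely `g₂` is spanned by two coroots and twelve iterated brackets of the generators
(`LieAlgebra.g₂.span_eq_top`), for which characteristic other than `2` suffices. Since the model has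
dimension `14`, the map is an isomorphism.
-/

/-! ### The coordinate model -/

/-- A coordinate model of the Lie algebra `S^σ[G^×]`: the coefficient `(a₁, a₂, a₃) ∈ S` of `g_i` is
recorded by `(a₁, a₂)`, and the index `i` is taken modulo 7, so that `g₇` has index `0`. -/
def G2Model (F : Type*) : Type _ := Fin 7 → F × F

namespace G2Model

section Twist

variable {F : Type*} [Field F]

/-- The bilinear map `σ_{i,i+1}` on `S`, in the coordinates `(a₁, a₂)`. -/
def twist₁ (a b : F × F) : F × F :=
  (-a.2 * b.1 - (a.1 + a.2) * (b.1 + b.2), a.2 * (b.1 + b.2) + (a.1 + a.2) * b.1)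

/-- The bilinear map `σ_{i,i+2}` on `S`, in the coordinates `(a₁, a₂)`. -/
def twist₂ (a b : F × F) : F × F :=
  (-a.2 * (b.1 + b.2), -a.1 * b.1 + (a.1 + a.2) * b.2)

/-- The bilinear map `σ_{i,i+4}` on `S`, in the coordinates `(a₁, a₂)`. -/
def twist₄ (a b : F × F) : F × F :=
  (-a.1 * b.2 + a.2 * (b.1 + b.2), -(a.1 + a.2) * b.1)

end Twist

variable {F : Type*} [Field F]

instance : AddCommGroup (G2Model F) := inferInstanceAs (AddCommGroup (Fin 7 → F × F))

instance {R : Type*} [Semiring R] [Module R F] : Module R (G2Model F) :=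
  inferInstanceAs (Module R (Fin 7 → F × F))

omit [Field F] in
@[ext]
theorem ext {u v : G2Model F} (h : ∀ k, u k = v k) : u = v := funext h

@[simp]
theorem zero_apply (k : Fin 7) : (0 : G2Model F) k = 0 := rfl

@[simp]
theorem add_apply (u v : G2Model F) (k : Fin 7) : (u + v) k = u k + v k := rfl

@[simp]
theorem smul_apply {R : Type*} [Semiring R] [Module R F] (c : R) (u : G2Model F) (k : Fin 7) :
    (c • u) k = c • u k := rfl

@[simp]
theorem neg_apply (u : G2Model F) (k : Fin 7) : (-u) k = -u k := rfl

@[simp]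
theorem sub_apply (u v : G2Model F) (k : Fin 7) : (u - v) k = u k - v k := rfl

/-- The three pairs of summands of the component at `k` come from the three lines
`{k - 3, k - 2, k}`, `{k - 1, k, k + 2}`, `{k, k + 1, k + 3}` of the Fano plane through `k`:
`g_i + g_{i+1} = g_{i+3}`, `g_i + g_{i+2} = g_{i-1}` and `g_i + g_{i+4} = g_{i-2}`. -/
instance : Bracket (G2Model F) (G2Model F) where
  bracket u v k :=
    twist₁ (u (k + 4)) (v (k + 5)) - twist₁ (v (k + 4)) (u (k + 5)) +
      (twist₂ (u (k + 1)) (v (k + 3)) - twist₂ (v (k + 1)) (u (k + 3))) +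
      (twist₄ (u (k + 2)) (v (k + 6)) - twist₄ (v (k + 2)) (u (k + 6)))

theorem lie_apply (u v : G2Model F) (k : Fin 7) :
    ⁅u, v⁆ k =
      twist₁ (u (k + 4)) (v (k + 5)) - twist₁ (v (k + 4)) (u (k + 5)) +
      (twist₂ (u (k + 1)) (v (k + 3)) - twist₂ (v (k + 1)) (u (k + 3))) +
      (twist₄ (u (k + 2)) (v (k + 6)) - twist₄ (v (k + 2)) (u (k + 6))) :=
  rfl

instance : LieRing (G2Model F) where
  add_lie u v w := by
    ext k <;> simp [lie_apply, twist₁, twist₂, twist₄] <;> ring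
  lie_add u v w := by
    ext k <;> simp [lie_apply, twist₁, twist₂, twist₄] <;> ring
  lie_self u := by
    ext k <;> simp [lie_apply]
  leibniz_lie u v w := by
    ext k <;>
    · simp only [lie_apply, twist₁, twist₂, twist₄, add_apply, add_assoc, Fin.reduceAdd, add_zero,
        Prod.fst_add, Prod.snd_add, Prod.fst_sub, Prod.snd_sub]
      ring

instance : LieAlgebra F (G2Model F) where
  lie_smul c u v := by
    ext k <;> simp [lie_apply, twist₁, twist₂, twist₄] <;> ring

/-- The element `s g_i` of the model. -/
def single (i : Fin 7) : F × F →ₗ[F] G2Model F := LinearMap.single F (fun _ => F × F) i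

theorem single_apply (i k : Fin 7) (s : F × F) : single i s k = if k = i then s else 0 :=
  Pi.single_apply i s k

theorem sum_single (i : Fin 7) (u : G2Model F) :
    u = single i (u i) + single (i + 1) (u (i + 1)) + single (i + 2) (u (i + 2)) +
      single (i + 3) (u (i + 3)) + single (i + 4) (u (i + 4)) + single (i + 5) (u (i + 5)) +
      single (i + 6) (u (i + 6)) := by
  ext1 k
  obtain ⟨n, rfl⟩ : ∃ n, k = i + n := ⟨k - i, by abel⟩
  fin_cases n <;> simp [single_apply]

theorem lie_single_self (i : Fin 7) (s t : F × F) : ⁅single i s, single i t⁆ = 0 := by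
  ext1 k
  obtain ⟨n, rfl⟩ : ∃ n, k = i + n := ⟨k - i, by abel⟩
  fin_cases n <;> simp [single_apply, lie_apply, add_assoc, twist₁, twist₂, twist₄]

theorem lie_single_add_one (i : Fin 7) (s t : F × F) :
    ⁅single i s, single (i + 1) t⁆ = single (i + 3) (twist₁ s t) := by
  ext1 k
  obtain ⟨n, rfl⟩ : ∃ n, k = i + n := ⟨k - i, by abel⟩
  fin_cases n <;> simp [single_apply, lie_apply, add_assoc, twist₁, twist₂, twist₄]

theorem lie_single_add_two (i : Fin 7) (s t : F × F) :
    ⁅single i s, single (i + 2) t⁆ = single (i + 6) (twist₂ s t) := by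
  ext1 k
  obtain ⟨n, rfl⟩ : ∃ n, k = i + n := ⟨k - i, by abel⟩
  fin_cases n <;> simp [single_apply, lie_apply, add_assoc, twist₁, twist₂, twist₄]

theorem lie_single_add_four (i : Fin 7) (s t : F × F) :
    ⁅single i s, single (i + 4) t⁆ = single (i + 5) (twist₄ s t) := by
  ext1 k
  obtain ⟨n, rfl⟩ : ∃ n, k = i + n := ⟨k - i, by abel⟩
  fin_cases n <;> simp [single_apply, lie_apply, add_assoc, twist₁, twist₂, twist₄]

theorem lie_single_add_three (i : Fin 7) (s t : F × F) :
    ⁅single i s, single (i + 3) t⁆ = single (i + 1) (-twist₄ t s) := by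
  have h := lie_single_add_four (i + 3) t s
  simp only [add_assoc, Fin.reduceAdd, add_zero] at h
  rw [← lie_skew, h, map_neg]

theorem lie_single_add_five (i : Fin 7) (s t : F × F) :
    ⁅single i s, single (i + 5) t⁆ = single (i + 4) (-twist₂ t s) := by
  have h := lie_single_add_two (i + 5) t s
  simp only [add_assoc, Fin.reduceAdd, add_zero] at h
  rw [← lie_skew, h, map_neg]

theorem lie_single_add_six (i : Fin 7) (s t : F × F) :
    ⁅single i s, single (i + 6) t⁆ = single (i + 2) (-twist₁ t s) := by
  have h := lie_single_add_one (i + 6) t s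
  simp only [add_assoc, Fin.reduceAdd, add_zero] at h
  rw [← lie_skew, h, map_neg]

end G2Model

/-! ### Simplicity of the model -/

namespace G2Model

variable {F : Type*} [Field F]

theorem finrank_eq : Module.finrank F (G2Model F) = 14 := by
  change Module.finrank F (Fin 7 → F × F) = 14
  simp [Module.finrank_pi_fintype]

theorem lie_single_left (i : Fin 7) (s : F × F) (u : G2Model F) :
    ⁅single i s, u⁆ =
      single (i + 1) (-twist₄ (u (i + 3)) s) + single (i + 2) (-twist₁ (u (i + 6)) s) +
      single (i + 3) (twist₁ s (u (i + 1))) + single (i + 4) (-twist₂ (u (i + 5)) s) +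
      single (i + 5) (twist₄ s (u (i + 4))) + single (i + 6) (twist₂ s (u (i + 2))) := by
  conv_lhs => rw [sum_single i u]
  simp only [lie_add, lie_single_self, lie_single_add_one, lie_single_add_two,
    lie_single_add_three, lie_single_add_four, lie_single_add_five, lie_single_add_six]
  abel

/-- The square of `ad ((0, 1, -1) g_i)`. On the line `{i, i + 1, i + 3}` it has the eigenvalues `-4`
(on `(1, 0, -1) g_{i+1}` and `(1, -1, 0) g_{i+3}`, the long root vectors) and `0`; off that line it
is `-1`. -/
theorem lie_lie_single (i : Fin 7) (u : G2Model F) :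
    ⁅single i ((0, 1) : F × F), ⁅single i ((0, 1) : F × F), u⁆⁆ =
      single (i + 1) (-2 * (2 * (u (i + 1)).1 + (u (i + 1)).2), 0) + single (i + 2) (-u (i + 2)) +
      single (i + 3) (-2 * ((u (i + 3)).1 - (u (i + 3)).2), 2 * ((u (i + 3)).1 - (u (i + 3)).2)) +
      single (i + 4) (-u (i + 4)) + single (i + 5) (-u (i + 5)) + single (i + 6) (-u (i + 6)) := by
  rw [lie_single_left i _ ⁅single i _, u⁆, lie_single_left i _ u]
  simp only [add_apply, single_apply, add_right_inj, Fin.reduceEq, if_true, if_false, zero_add,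
    add_zero]
  congr <;> ext <;> simp [twist₁, twist₂, twist₄] <;> ring

/-- With `T = ad ((0, 1, -1) g_i) ^ 2`, the operator `T (T + 1)` is `12` times the projection to the
`-4`-eigenspace of `T`, a plane. -/
theorem lie_lie_single_add_lie_single (i : Fin 7) (u : G2Model F) :
    letI T := fun v : G2Model F => ⁅single i ((0, 1) : F × F), ⁅single i ((0, 1) : F × F), v⁆⁆
    T (T u) + T u =
      single (i + 1) ((6 * (2 * (u (i + 1)).1 + (u (i + 1)).2)) • (1, 0)) +
        single (i + 3) ((6 * ((u (i + 3)).1 - (u (i + 3)).2)) • (1, -1)) := by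
  simp only
  rw [lie_lie_single i ⁅single i _, _⁆, lie_lie_single i u]
  ext1 k
  obtain ⟨n, rfl⟩ : ∃ n, k = i + n := ⟨k - i, by abel⟩
  simp only [add_apply, single_apply, add_right_inj]
  fin_cases n <;> simp <;> try constructor
  all_goals ring

theorem lie_lie_single_add_one (i : Fin 7) (s t : F × F) :
    ⁅single i s, ⁅single i s, single (i + 1) t⁆⁆ = single (i + 1) (-twist₄ (twist₁ s t) s) := by
  rw [lie_single_add_one, lie_single_add_three]

theorem lie_lie_single_add_six (i : Fin 7) (s t : F × F) :
    ⁅single i s, ⁅single i s, single (i + 6) t⁆⁆ = single (i + 6) (twist₂ s (-twist₁ t s)) := by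
  rw [lie_single_add_six, lie_single_add_two]

/-- An ideal contains multiples of two fixed vectors `(1, 1, -2) g_j` and `(1, -2, 1) g_j` that detect
whether the component of a member at `j` vanishes. -/
theorem single_mem_of_mem (I : LieIdeal F (G2Model F)) {u : G2Model F} (hu : u ∈ I) (j : Fin 7) :
    (6 * ((u j).1 - (u j).2)) • single j (1, 1) ∈ I ∧
      (6 * (2 * (u j).1 + (u j).2)) • single j (1, -2) ∈ I := by
  have hI {v w : G2Model F} (hv : v ∈ I) : ⁅w, ⁅w, v⁆⁆ + v ∈ I :=
    I.add_mem (I.lie_mem (I.lie_mem hv)) hv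
  have hT (i : Fin 7) := lie_lie_single_add_lie_single i u ▸
    I.add_mem (I.lie_mem (I.lie_mem (I.lie_mem (I.lie_mem hu)))) (I.lie_mem (I.lie_mem hu))
  -- Apply `T' + 1` with `T'` the square of `ad (w g_{i+2})`. Of the two lines `{i + 1, i + 2, i + 4}`
  -- and `{i + 2, i + 3, i + 5}` through `i + 2`, the choice of `w` makes one special; on the other
  -- one `T' = -1`, so that this part of the plane is removed.
  constructor
  · obtain ⟨i, rfl⟩ : ∃ i, j = i + 3 := ⟨j - 3, by abel⟩
    have h := neg_mem (hI (w := single (i + 2) (0, 1)) (hT i))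
    have h1 := lie_lie_single_add_one (F := F) (i + 2)
    have h6 := lie_lie_single_add_six (F := F) (i + 2)
    simp only [add_assoc, Fin.reduceAdd] at h1 h6
    rw [lie_add, lie_add, h1, h6, add_add_add_comm, ← map_add, ← map_add] at h
    convert h using 1
    rw [← map_smul, neg_add, ← map_neg, ← map_neg]
    refine (zero_add _).symm.trans (congrArg₂ _ ?_ (congrArg _ ?_))
    · refine .symm (.trans (congrArg _ ?_) (map_zero (single (i + 1))))
      ext <;> simp [twist₁, twist₂]
    · ext <;> simp [twist₁, twist₄]
  · obtain ⟨i, rfl⟩ : ∃ i, j = i + 1 := ⟨j - 1, by abel⟩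
    have h := hI (w := single (i + 2) (1, 0)) (hT i)
    have h1 := lie_lie_single_add_one (F := F) (i + 2)
    have h6 := lie_lie_single_add_six (F := F) (i + 2)
    simp only [add_assoc, Fin.reduceAdd] at h1 h6
    rw [lie_add, lie_add, h1, h6, add_add_add_comm, ← map_add, ← map_add] at h
    convert h using 1
    rw [← map_smul]
    refine (add_zero _).symm.trans (congrArg₂ _ (congrArg _ ?_) ?_)
    · ext <;> simp [twist₁, twist₂]
      ring
    · refine .symm (.trans (congrArg _ ?_) (map_zero (single (i + 3))))
      ext <;> simp [twist₁, twist₄]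

/-- As `[S g_i, S g_{i+3}] = S g_{i+1}`, an ideal with one of the `S g_i` contains all of them. -/
theorem eq_top_of_single_mem (I : LieIdeal F (G2Model F)) (i : Fin 7)
    (hi : ∀ t, single i t ∈ I) : I = ⊤ := by
  have step (k : Fin 7) (hk : ∀ t, single k t ∈ I) (t) : single (k + 1) t ∈ I := by
    have h := lie_mem_left F (G2Model F) I _ (single (k + 3) (1, 0)) (hk (t.2, t.1))
    rw [lie_single_add_three] at h
    convert h using 2
    simp [twist₄]
  have all (n : ℕ) : ∀ t, single (i + Fin.ofNat 7 n) t ∈ I := by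
    induction n with
    | zero => simpa using hi
    | succ n ih =>
      have h : Fin.ofNat 7 (n + 1) = Fin.ofNat 7 n + 1 := by
        ext
        simp [Fin.val_add]
      rw [h, ← add_assoc]
      exact step _ ih
  have all' (k : Fin 7) (t) : single k t ∈ I := by
    simpa using all ((k - i : Fin 7) : ℕ) t
  rw [eq_top_iff]
  intro u _
  rw [sum_single 0 u]
  repeat first | exact all' _ _ | refine I.add_mem ?_ (all' _ _)

theorem isSimple (h2 : (2 : F) ≠ 0) (h3 : (3 : F) ≠ 0) : LieAlgebra.IsSimple F (G2Model F) where
  eq_bot_or_eq_top I := by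
    refine or_iff_not_imp_left.2 fun hI => ?_
    obtain ⟨u, hu, hu0⟩ := I.toSubmodule.ne_bot_iff.1 (mt (LieSubmodule.toSubmodule_eq_bot I).1 hI)
    obtain ⟨j, hj⟩ : ∃ j, u j ≠ 0 := by
      by_contra! h
      exact hu0 (ext h)
    have h6 : (6 : F) ≠ 0 := by
      have := mul_ne_zero h2 h3
      norm_num at this
      exact this
    obtain ⟨hA, hB⟩ := single_mem_of_mem I hu j
    by_cases hab : (u j).1 = (u j).2
    · have h0 : 6 * (2 * (u j).1 + (u j).2) ≠ 0 := by
        refine mul_ne_zero h6 fun h => hj ?_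
        have h' : (3 : F) * (u j).2 = 0 := by
          rw [hab] at h
          linear_combination h
        have h'' := (mul_eq_zero.1 h').resolve_left h3
        exact Prod.ext (hab.trans h'') h''
      have hd := (I.smul_mem_iff h0).1 hB
      refine eq_top_of_single_mem I (j + 3) fun t => ?_
      have h := lie_mem_left F (G2Model F) I _
        (single (j + 1) ((2 * t.1 + t.2) / 3, -(t.1 + t.2))) hd
      rw [lie_single_add_one] at h
      convert h using 2
      ext <;> simp [twist₁] <;> field_simp <;> ring
    · have hd := (I.smul_mem_iff (mul_ne_zero h6 (sub_ne_zero.2 hab))).1 hA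
      refine eq_top_of_single_mem I (j + 3) fun t => ?_
      have h := lie_mem_left F (G2Model F) I _
        (single (j + 1) ((t.1 + 2 * t.2) / 3, -(t.1 + t.2))) hd
      rw [lie_single_add_one] at h
      convert h using 2
      ext <;> simp [twist₁] <;> field_simp <;> ring
  non_abelian h := by
    have h1 := lie_single_add_three (F := F) 0 (1, 0) (1, 0)
    rw [h.trivial] at h1
    have := congrArg (fun v : G2Model F => (v 1).2) h1
    simp [single_apply, twist₄] at this

end G2Model

/-! ### Lie algebras presented by Serre's relations -/

namespace Matrix

/-- Serre's relations for the matrix `A` between the elements `e i`, `h i`, `f i` of a Lie algebra, in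
the form in which they define `Matrix.ToLieAlgebra`. -/
structure SerreRelations {B L : Type*} (R : Type*) [DecidableEq B] [CommRing R] [LieRing L]
    [LieAlgebra R L]
    (A : Matrix B B ℤ) (e h f : B → L) : Prop where
  hh : ∀ i j, ⁅h i, h j⁆ = 0
  ef : ∀ i j, ⁅e i, f j⁆ = if i = j then h i else 0
  he : ∀ i j, ⁅h i, e j⁆ = A i j • e j
  hf : ∀ i j, ⁅h i, f j⁆ = -(A i j • f j)
  ade : ∀ i j, ((LieAlgebra.ad R L (e i)) ^ (-A i j).toNat) ⁅e i, e j⁆ = 0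
  adf : ∀ i j, ((LieAlgebra.ad R L (f i)) ^ (-A i j).toNat) ⁅f i, f j⁆ = 0

namespace SerreRelations

variable {B L : Type*} (R : Type*) [DecidableEq B] [CommRing R] [LieRing L] [LieAlgebra R L]
  {A : Matrix B B ℤ} {e h f : B → L}

variable {R} in
/-- The Chevalley involution: Serre's relations are invariant under `(e, h, f) ↦ (f, -h, e)`. -/
theorem symm (H : SerreRelations R A e h f) : SerreRelations R A f (-h) e where
  hh i j := by simp [H.hh]
  ef i j := by
    rw [← lie_skew, H.ef]
    simp only [eq_comm (a := j)]
    split_ifs with hij <;> simp [hij]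
  he i j := by simp [H.hf]
  hf i j := by simp [H.he]
  ade := H.adf
  adf := H.ade

end SerreRelations

namespace ToLieAlgebra

theorem _root_.LieHom.map_ad_pow {R L L' : Type*} [CommRing R] [LieRing L] [LieAlgebra R L]
    [LieRing L'] [LieAlgebra R L'] (φ : L →ₗ⁅R⁆ L') (x y : L) (n : ℕ) :
    φ ((LieAlgebra.ad R L x ^ n) y) = (LieAlgebra.ad R L' (φ x) ^ n) (φ y) := by
  induction n with
  | zero => simp
  | succ n ih => simp [pow_succ', ih]

open CartanMatrix LieAlgebra

variable {B L : Type*} (R : Type*) [DecidableEq B] [CommRing R] [LieRing L] [LieAlgebra R L]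
  (A : Matrix B B ℤ)

/-- The projection from the free Lie algebra on the generators. -/
noncomputable def mk : FreeLieAlgebra R (Generators B) →ₗ⁅R⁆ A.ToLieAlgebra R where
  toFun := LieSubmodule.Quotient.mk (N := Relations.toIdeal R A)
  map_add' _ _ := rfl
  map_smul' _ _ := rfl
  map_lie' {x y} := LieSubmodule.Quotient.mk_bracket (I := Relations.toIdeal R A) x y

theorem mk_surjective : Function.Surjective (mk R A) := Quot.mk_surjective

theorem mk_eq_zero {x : FreeLieAlgebra R (Generators B)} (hx : x ∈ Relations.toSet R A) :
    mk R A x = 0 :=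
  LieSubmodule.Quotient.mk_eq_zero'.2 (LieSubmodule.subset_lieSpan hx)

/-- The image of a generator in the Lie algebra of the matrix `A`. -/
noncomputable def of (x : Generators B) : A.ToLieAlgebra R := mk R A (FreeLieAlgebra.of R x)

theorem serreRelations :
    SerreRelations R A (fun i => of R A (.E i)) (fun i => of R A (.H i))
      (fun i => of R A (.F i)) where
  hh i j := by
    have h := mk_eq_zero R A (x := Relations.HH R (i, j)) (by simp [Relations.toSet])
    simpa [of, Relations.HH] using h
  ef i j := by
    have h := mk_eq_zero R A (x := Relations.EF R (i, j)) (by simp [Relations.toSet])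
    by_cases hij : i = j
    · subst hij
      simpa [of, Relations.EF, sub_eq_zero] using h
    · simpa [of, Relations.EF, hij] using h
  he i j := by
    have h := mk_eq_zero R A (x := Relations.HE R A (i, j)) (by simp [Relations.toSet])
    simpa [of, Relations.HE, sub_eq_zero] using h
  hf i j := by
    have h := mk_eq_zero R A (x := Relations.HF R A (i, j)) (by simp [Relations.toSet])
    simpa [of, Relations.HF, add_eq_zero_iff_eq_neg] using h
  ade i j := by
    have h := mk_eq_zero R A (x := Relations.adE R A (i, j)) (by simp [Relations.toSet])
    simpa [of, Relations.adE, LieHom.map_ad_pow] using h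
  adf i j := by
    have h := mk_eq_zero R A (x := Relations.adF R A (i, j)) (by simp [Relations.toSet])
    simpa [of, Relations.adF, LieHom.map_ad_pow] using h

variable {A} in
/-- The universal property of the Lie algebra presented by Serre's relations. -/
theorem exists_lift {e h f : B → L} (H : SerreRelations R A e h f) :
    ∃ φ : A.ToLieAlgebra R →ₗ⁅R⁆ L, (∀ i, φ (of R A (.E i)) = e i) ∧
      (∀ i, φ (of R A (.H i)) = h i) ∧ (∀ i, φ (of R A (.F i)) = f i) := by
  let g : FreeLieAlgebra R (Generators B) →ₗ⁅R⁆ L := FreeLieAlgebra.lift R fun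
    | .H i => h i
    | .E i => e i
    | .F i => f i
  have hg : Relations.toIdeal R A ≤ g.ker := by
    refine LieSubmodule.lieSpan_le.2 ?_
    rintro _ (((((⟨⟨i, j⟩, rfl⟩ | ⟨⟨i, j⟩, rfl⟩) | ⟨⟨i, j⟩, rfl⟩) | ⟨⟨i, j⟩, rfl⟩) |
      ⟨⟨i, j⟩, rfl⟩) | ⟨⟨i, j⟩, rfl⟩)
    · simp [g, Relations.HH, H.hh]
    · by_cases hij : i = j
      · subst hij
        simp [g, Relations.EF, H.ef]
      · simp [g, Relations.EF, H.ef, hij]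
    · simp [g, Relations.HE, H.he]
    · simp [g, Relations.HF, H.hf]
    · simp [g, Relations.adE, LieHom.map_ad_pow, H.ade]
    · simp [g, Relations.adF, LieHom.map_ad_pow, H.adf]
  let φ : A.ToLieAlgebra R →ₗ⁅R⁆ L :=
    { (Relations.toIdeal R A).toSubmodule.liftQ (g : FreeLieAlgebra R (Generators B) →ₗ[R] L) hg with
      map_lie' := by
        intro x y
        obtain ⟨x, rfl⟩ := mk_surjective R A x
        obtain ⟨y, rfl⟩ := mk_surjective R A y
        exact LieHom.map_lie g x y }
  have hφ (x) : φ (of R A x) = g (FreeLieAlgebra.of R x) := rfl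
  refine ⟨φ, fun i => ?_, fun i => ?_, fun i => ?_⟩ <;> simp [hφ, g]

theorem eq_top_of_forall_of_mem (S : LieSubalgebra R (A.ToLieAlgebra R))
    (hS : ∀ x, of R A x ∈ S) : S = ⊤ := by
  rw [eq_top_iff]
  rintro x -
  obtain ⟨x, rfl⟩ := mk_surjective R A x
  let g : FreeLieAlgebra R (Generators B) →ₗ⁅R⁆ S := FreeLieAlgebra.lift R fun x => ⟨of R A x, hS x⟩
  have hg : S.incl.comp g = mk R A := FreeLieAlgebra.hom_ext fun x => by
    simp [g, of]
  rw [← hg]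
  exact (g x).2

end ToLieAlgebra

end Matrix

/-! ### The dimension of the presented Lie algebra of type `G₂` -/

namespace Matrix.SerreRelations

open CartanMatrix

variable {R L : Type*} [Field R] [LieRing L] [LieAlgebra R L] {e h f : Fin 2 → L}

/-- The six positive root vectors generated by `e 0` (short) and `e 1` (long) in type `G₂`. -/
def g₂RootVector (e : Fin 2 → L) : Fin 6 → L :=
  ![e 0, e 1, ⁅e 0, e 1⁆, ⁅e 0, ⁅e 0, e 1⁆⁆, ⁅e 0, ⁅e 0, ⁅e 0, e 1⁆⁆⁆,
    ⁅e 1, ⁅e 0, ⁅e 0, ⁅e 0, e 1⁆⁆⁆⁆]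

/-- Serre's relations for type `G₂`, written out. -/
theorem mk_G₂ (hh : ⁅h 0, h 1⁆ = 0) (ef₀ : ⁅e 0, f 0⁆ = h 0) (ef₁ : ⁅e 1, f 1⁆ = h 1)
    (ef₀₁ : ⁅e 0, f 1⁆ = 0) (ef₁₀ : ⁅e 1, f 0⁆ = 0)
    (he : ∀ i j, ⁅h i, e j⁆ = G₂ i j • e j) (hf : ∀ i j, ⁅h i, f j⁆ = -(G₂ i j • f j))
    (ade₀ : ⁅e 0, ⁅e 0, ⁅e 0, ⁅e 0, e 1⁆⁆⁆⁆ = 0) (ade₁ : ⁅e 1, ⁅e 1, e 0⁆⁆ = 0)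
    (adf₀ : ⁅f 0, ⁅f 0, ⁅f 0, ⁅f 0, f 1⁆⁆⁆⁆ = 0) (adf₁ : ⁅f 1, ⁅f 1, f 0⁆⁆ = 0) :
    SerreRelations R G₂ e h f where
  hh := by
    have : ⁅h 1, h 0⁆ = 0 := by rw [← lie_skew, hh, neg_zero]
    simp [Fin.forall_fin_two, hh, this]
  ef := by simp [Fin.forall_fin_two, *]
  he := he
  hf := hf
  ade := by
    simp [Fin.forall_fin_two, G₂, pow_succ, ade₀, ade₁]
  adf := by
    simp [Fin.forall_fin_two, G₂, pow_succ, adf₀, adf₁]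

theorem ade₀_G₂ (H : SerreRelations R G₂ e h f) : ⁅e 0, ⁅e 0, ⁅e 0, ⁅e 0, e 1⁆⁆⁆⁆ = 0 := by
  simpa [G₂, pow_succ] using H.ade 0 1

theorem ade₁_G₂ (H : SerreRelations R G₂ e h f) : ⁅e 1, ⁅e 0, e 1⁆⁆ = 0 := by
  have h : ⁅e 1, ⁅e 1, e 0⁆⁆ = 0 := by simpa [G₂, pow_succ] using H.ade 1 0
  rw [← lie_skew (e 0) (e 1), lie_neg, h, neg_zero]

/-- The positive root vectors span a subspace stable under `e 0` and `e 1`. Apart from Serre's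
relations, this uses the consequences `[e₁, y₂] = 0`, `[y₁, y₃] = 0`, `[e₁, [e₁, y₃]] = 0` with
`y_k = (ad e₀)^k e₁`, obtained by applying `ad e₀` to `[e₁, y₁] = 0`; the second one needs
`2 ≠ 0`. -/
theorem lie_e_g₂RootVector (H : SerreRelations R G₂ e h f) (h2 : (2 : R) ≠ 0) (i : Fin 2)
    (k : Fin 6) : ⁅e i, g₂RootVector e k⁆ ∈ Submodule.span R (Set.range (g₂RootVector e)) := by
  have mem (k : Fin 6) : g₂RootVector e k ∈ Submodule.span R (Set.range (g₂RootVector e)) :=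
    Submodule.subset_span ⟨k, rfl⟩
  have zero_mem' {v : L} (hv : v = 0) : v ∈ Submodule.span R (Set.range (g₂RootVector e)) :=
    hv ▸ zero_mem _
  have h₀₄ := H.ade₀_G₂
  have h₁₂ := H.ade₁_G₂
  set x := e 0 with hx
  set y := e 1 with hy
  set y₁ := ⁅x, y⁆ with hy₁
  set y₂ := ⁅x, y₁⁆ with hy₂
  set y₃ := ⁅x, y₂⁆ with hy₃
  have h₁₃ : ⁅y, y₂⁆ = 0 := by
    have := leibniz_lie x y y₁
    rw [h₁₂, lie_zero, ← hy₁, lie_self, zero_add] at this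
    exact this.symm
  have h₂₃ : ⁅y₁, y₂⁆ = -⁅y, y₃⁆ := by
    have := leibniz_lie x y y₂
    rw [h₁₃, lie_zero, ← hy₁] at this
    exact eq_neg_of_add_eq_zero_left this.symm
  have h₂₄ : ⁅y₁, y₃⁆ = 0 := by
    have h₁ := leibniz_lie x y₁ y₂
    have h₂ := leibniz_lie x y y₃
    rw [h₀₄, lie_zero, add_zero, ← hy₁] at h₂
    rw [← hy₂, lie_self, zero_add, h₂₃, lie_neg, h₂, ← hy₃] at h₁
    have h₃ : (2 : R) • ⁅y₁, y₃⁆ = 0 := by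
      rw [two_smul]
      nth_rewrite 1 [← h₁]
      exact neg_add_cancel _
    exact (smul_eq_zero.1 h₃).resolve_left h2
  have h₁₅ : ⁅y, ⁅y, y₃⁆⁆ = 0 := by
    have := leibniz_lie y y₁ y₂
    rw [h₂₃, h₁₂, h₁₃, zero_lie, lie_zero, lie_neg, add_zero] at this
    exact neg_eq_zero.1 this
  have h₀₅ : ⁅x, ⁅y, y₃⁆⁆ = 0 := by
    rw [leibniz_lie, ← hy₁, h₂₄, h₀₄, lie_zero, zero_add]
  have h₁₀ : ⁅y, x⁆ = -y₁ := (lie_skew y x).symm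
  fin_cases i <;> fin_cases k
  · simp [g₂RootVector]
  · exact mem 2
  · exact mem 3
  · exact mem 4
  · exact zero_mem' h₀₄
  · exact zero_mem' h₀₅
  · change ⁅y, x⁆ ∈ _
    rw [h₁₀]
    exact neg_mem (mem 2)
  · simp [g₂RootVector]
  · exact zero_mem' h₁₂
  · exact zero_mem' h₁₃
  · exact mem 5
  · exact zero_mem' h₁₅

theorem lie_f_g₂RootVector (H : SerreRelations R G₂ e h f) (i : Fin 2) (k : Fin 6) :
    ⁅f i, g₂RootVector e k⁆ ∈
      Submodule.span R (Set.range h) ⊔ Submodule.span R (Set.range (g₂RootVector e)) := by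
  have mem (k : Fin 6) : g₂RootVector e k ∈
      Submodule.span R (Set.range h) ⊔ Submodule.span R (Set.range (g₂RootVector e)) :=
    Submodule.mem_sup_right (Submodule.subset_span ⟨k, rfl⟩)
  have memh (i : Fin 2) : h i ∈
      Submodule.span R (Set.range h) ⊔ Submodule.span R (Set.range (g₂RootVector e)) :=
    Submodule.mem_sup_left (Submodule.subset_span ⟨i, rfl⟩)
  have fe (i j : Fin 2) : ⁅f i, e j⁆ = if i = j then -h i else 0 := by
    rw [← lie_skew, H.ef]
    split_ifs <;> simp_all
  have h00 : ⁅h 0, e 0⁆ = (2 : ℤ) • e 0 := H.he 0 0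
  have h01 : ⁅h 0, e 1⁆ = (-3 : ℤ) • e 1 := H.he 0 1
  have h10 : ⁅h 1, e 0⁆ = (-1 : ℤ) • e 0 := H.he 1 0
  have h11 : ⁅h 1, e 1⁆ = (2 : ℤ) • e 1 := H.he 1 1
  have f00 : ⁅f 0, e 0⁆ = -h 0 := by simp [fe]
  have f01 : ⁅f 0, e 1⁆ = 0 := by simp [fe]
  have f10 : ⁅f 1, e 0⁆ = 0 := by simp [fe]
  have f11 : ⁅f 1, e 1⁆ = -h 1 := by simp [fe]
  have f02 : ⁅f 0, ⁅e 0, e 1⁆⁆ = (3 : ℤ) • e 1 := by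
    rw [leibniz_lie, f00, f01, neg_lie, h01, lie_zero]
    module
  have f03 : ⁅f 0, ⁅e 0, ⁅e 0, e 1⁆⁆⁆ = (4 : ℤ) • ⁅e 0, e 1⁆ := by
    rw [leibniz_lie, f02, f00, neg_lie, leibniz_lie (h 0), h00, h01]
    simp only [smul_lie, lie_smul]
    module
  have f04 : ⁅f 0, ⁅e 0, ⁅e 0, ⁅e 0, e 1⁆⁆⁆⁆ = (3 : ℤ) • ⁅e 0, ⁅e 0, e 1⁆⁆ := by
    rw [leibniz_lie, f03, f00, neg_lie, leibniz_lie (h 0), leibniz_lie (h 0), h00, h01]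
    simp only [smul_lie, lie_smul, lie_add]
    module
  have f05 : ⁅f 0, ⁅e 1, ⁅e 0, ⁅e 0, ⁅e 0, e 1⁆⁆⁆⁆⁆ = 0 := by
    rw [leibniz_lie, f04, f01, zero_lie, zero_add, lie_smul, leibniz_lie, H.ade₁_G₂,
      lie_zero, add_zero, ← lie_skew (e 1) (e 0), neg_lie, lie_self]
    simp
  have f12 : ⁅f 1, ⁅e 0, e 1⁆⁆ = -e 0 := by
    rw [leibniz_lie, f10, f11, zero_lie, zero_add, lie_neg, ← lie_skew, neg_neg, h10]
    module
  have f13 : ⁅f 1, ⁅e 0, ⁅e 0, e 1⁆⁆⁆ = 0 := by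
    rw [leibniz_lie, f10, f12]
    simp
  have f14 : ⁅f 1, ⁅e 0, ⁅e 0, ⁅e 0, e 1⁆⁆⁆⁆ = 0 := by
    rw [leibniz_lie, f10, f13]
    simp
  have f15 : ⁅f 1, ⁅e 1, ⁅e 0, ⁅e 0, ⁅e 0, e 1⁆⁆⁆⁆⁆ = ⁅e 0, ⁅e 0, ⁅e 0, e 1⁆⁆⁆ := by
    rw [leibniz_lie, f11, f14, neg_lie, leibniz_lie (h 1), leibniz_lie (h 1), leibniz_lie (h 1),
      h10, h11]
    simp only [smul_lie, lie_smul, lie_add, lie_zero]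
    module
  fin_cases i <;> fin_cases k
  · exact f00 ▸ neg_mem (memh 0)
  · simp [g₂RootVector, f01]
  · exact f02 ▸ zsmul_mem (mem 1) 3
  · exact f03 ▸ zsmul_mem (mem 2) 4
  · exact f04 ▸ zsmul_mem (mem 3) 3
  · simp [g₂RootVector, f05]
  · simp [g₂RootVector, f10]
  · exact f11 ▸ neg_mem (memh 1)
  · exact f12 ▸ neg_mem (mem 0)
  · simp [g₂RootVector, f13]
  · simp [g₂RootVector, f14]
  · exact f15 ▸ mem 4

/-- The span of the coroots and of the positive and negative root vectors of type `G₂`. -/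
def g₂Span (R : Type*) [Field R] [LieAlgebra R L] (e h f : Fin 2 → L) : Submodule R L :=
  Submodule.span R (Set.range h) ⊔ Submodule.span R (Set.range (g₂RootVector e)) ⊔
    Submodule.span R (Set.range (g₂RootVector f))

theorem finrank_g₂Span_le (e h f : Fin 2 → L) : Module.finrank R (g₂Span R e h f) ≤ 14 := by
  have h₁ := finrank_range_le_card (R := R) h
  have h₂ := finrank_range_le_card (R := R) (g₂RootVector e)
  have h₃ := finrank_range_le_card (R := R) (g₂RootVector f)
  simp only [Set.finrank, Fintype.card_fin] at h₁ h₂ h₃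
  unfold g₂Span
  have := FiniteDimensional.span_of_finite R (Set.finite_range h)
  have := FiniteDimensional.span_of_finite R (Set.finite_range (g₂RootVector e))
  have := FiniteDimensional.span_of_finite R (Set.finite_range (g₂RootVector f))
  refine (Submodule.finrank_add_le_finrank_add_finrank _ _).trans ?_
  have := Submodule.finrank_add_le_finrank_add_finrank (Submodule.span R (Set.range h))
    (Submodule.span R (Set.range (g₂RootVector e)))
  lia

theorem g₂Span_symm (e h f : Fin 2 → L) : g₂Span R f (-h) e = g₂Span R e h f := by
  have : Submodule.span R (Set.range (-h)) = Submodule.span R (Set.range h) := by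
    rw [← Set.neg_range', Submodule.span_neg]
  rw [g₂Span, g₂Span, this, sup_right_comm]

theorem lie_e_mem_g₂Span (H : SerreRelations R G₂ e h f) (h2 : (2 : R) ≠ 0) (i : Fin 2) {v : L}
    (hv : v ∈ g₂Span R e h f) : ⁅e i, v⁆ ∈ g₂Span R e h f := by
  suffices g₂Span R e h f ≤ (g₂Span R e h f).comap (LieAlgebra.ad R L (e i) : L →ₗ[R] L) from this hv
  refine sup_le (sup_le ?_ ?_) ?_ <;> rw [Submodule.span_le] <;> rintro _ ⟨k, rfl⟩
  · change ⁅e i, h k⁆ ∈ g₂Span R e h f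
    rw [← lie_skew, H.he]
    refine neg_mem (zsmul_mem (Submodule.mem_sup_left (Submodule.mem_sup_right ?_)) _)
    refine Submodule.subset_span ?_
    fin_cases i
    exacts [⟨0, rfl⟩, ⟨1, rfl⟩]
  · exact Submodule.mem_sup_left (Submodule.mem_sup_right (H.lie_e_g₂RootVector h2 i k))
  · -- The Chevalley involution turns this into the action of `f` on positive root vectors.
    rw [← g₂Span_symm]
    have := H.symm.lie_f_g₂RootVector i k
    exact Submodule.mem_sup_left this

theorem lie_f_mem_g₂Span (H : SerreRelations R G₂ e h f) (h2 : (2 : R) ≠ 0) (i : Fin 2) {v : L}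
    (hv : v ∈ g₂Span R e h f) : ⁅f i, v⁆ ∈ g₂Span R e h f := by
  rw [← g₂Span_symm] at hv ⊢
  exact H.symm.lie_e_mem_g₂Span h2 i hv

end Matrix.SerreRelations

namespace LieAlgebra.g₂

open CartanMatrix Matrix

variable (R : Type*) [Field R]

theorem span_eq_top (h2 : (2 : R) ≠ 0) :
    SerreRelations.g₂Span R (fun i => ToLieAlgebra.of R G₂ (.E i))
      (fun i => ToLieAlgebra.of R G₂ (.H i)) (fun i => ToLieAlgebra.of R G₂ (.F i)) = ⊤ := by
  have H := ToLieAlgebra.serreRelations R G₂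
  set N := SerreRelations.g₂Span R (fun i => ToLieAlgebra.of R G₂ (.E i))
      (fun i => ToLieAlgebra.of R G₂ (.H i)) (fun i => ToLieAlgebra.of R G₂ (.F i)) with hN
  -- The elements that stabilize `N` form a subalgebra, which contains the generators.
  let S : LieSubalgebra R (LieAlgebra.g₂ R) :=
    { carrier := {a | ∀ v ∈ N, ⁅a, v⁆ ∈ N}
      add_mem' := fun ha hb v hv => by
        rw [add_lie]
        exact add_mem (ha v hv) (hb v hv)
      zero_mem' := fun v _ => by simp
      smul_mem' := fun c a ha v hv => by
        rw [smul_lie]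
        exact N.smul_mem c (ha v hv)
      lie_mem' := fun {a b} ha hb v hv => by
        rw [lie_lie]
        exact sub_mem (ha _ (hb v hv)) (hb _ (ha v hv)) }
  have hE (i : Fin 2) : ToLieAlgebra.of R G₂ (.E i) ∈ S := fun v hv => H.lie_e_mem_g₂Span h2 i hv
  have hF (i : Fin 2) : ToLieAlgebra.of R G₂ (.F i) ∈ S := fun v hv => H.lie_f_mem_g₂Span h2 i hv
  have hS : S = ⊤ := by
    refine ToLieAlgebra.eq_top_of_forall_of_mem R G₂ S fun x => ?_
    cases x with
    | H i =>
      have h := H.ef i i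
      rw [if_pos rfl] at h
      exact h ▸ S.lie_mem (hE i) (hF i)
    | E i => exact hE i
    | F i => exact hF i
  -- So `N` itself is a subalgebra, and it contains the generators.
  let N' : LieSubalgebra R (LieAlgebra.g₂ R) :=
    { N with lie_mem' := fun {a b} _ hb => (hS ▸ LieSubalgebra.mem_top a : a ∈ S) b hb }
  have hN' : N' = ⊤ := by
    refine ToLieAlgebra.eq_top_of_forall_of_mem R G₂ N' fun x => ?_
    change _ ∈ N
    cases x with
    | H i =>
      exact Submodule.mem_sup_left (Submodule.mem_sup_left (Submodule.subset_span ⟨i, rfl⟩))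
    | E i =>
      refine Submodule.mem_sup_left (Submodule.mem_sup_right (Submodule.subset_span ?_))
      fin_cases i
      exacts [⟨0, rfl⟩, ⟨1, rfl⟩]
    | F i =>
      refine Submodule.mem_sup_right (Submodule.subset_span ?_)
      fin_cases i
      exacts [⟨0, rfl⟩, ⟨1, rfl⟩]
  rw [eq_top_iff]
  intro x _
  exact (hN' ▸ LieSubalgebra.mem_top x : x ∈ N')

theorem finite (h2 : (2 : R) ≠ 0) : Module.Finite R (LieAlgebra.g₂ R) := by
  refine ⟨?_⟩
  rw [← span_eq_top R h2]
  exact ((Submodule.fg_span (Set.finite_range _)).sup (Submodule.fg_span (Set.finite_range _))).sup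
    (Submodule.fg_span (Set.finite_range _))

theorem finrank_le (h2 : (2 : R) ≠ 0) : Module.finrank R (LieAlgebra.g₂ R) ≤ 14 := by
  rw [← finrank_top, ← span_eq_top R h2]
  exact SerreRelations.finrank_g₂Span_le _ _ _

end LieAlgebra.g₂

/-! ### Chevalley generators of the model -/

namespace G2Model

variable {F : Type*} [Field F]

instance : Module.Finite F (G2Model F) := inferInstanceAs (Module.Finite F (Fin 7 → F × F))

/-- The positive Chevalley generators `e₀` (short root) and `e₁` (long root) of the model, for the
Cartan subalgebra `S g₇` (index `0`), which is diagonalizable once there is a square root `ι` of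
`-1`: `e₀ = (1, -2, 1) g₁ - ι (1, 1, -2) g₃` and `e₁ = (0, 1, -1) g₄ - ι (1, 0, -1) g₅`. Replacing
`ι` by `-ι` gives the negative generators, up to a factor `-1 / 4`. -/
def eGen (ι : F) : Fin 2 → G2Model F :=
  ![single 1 (1, -2) - ι • single 3 (1, 1), single 4 (0, 1) - ι • single 5 (1, 0)]

/-- The coroots `h₀ = -ι (2, -1, -1) g₇` and `h₁ = -ι (-1, 1, 0) g₇` of the model. -/
def hGen (ι : F) : Fin 2 → G2Model F := ![-(ι • single 0 (2, -1)), -(ι • single 0 (-1, 1))]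

theorem hGen_neg (ι : F) : hGen (-ι) = -hGen ι := by
  ext i <;> fin_cases i <;> simp [hGen]

theorem lie_hGen_eGen {ι : F} (hι : ι * ι = -1) (i j : Fin 2) :
    ⁅hGen ι i, eGen ι j⁆ = CartanMatrix.G₂ i j • eGen ι j := by
  rw [← Int.cast_smul_eq_zsmul F]
  fin_cases i <;> fin_cases j
  all_goals
    ext k <;> fin_cases k
  all_goals
    simp [lie_apply, CartanMatrix.G₂, eGen, hGen, single_apply, twist₁, twist₂, twist₄]
  all_goals grind

theorem lie_eGen_eGen {ι : F} (hι : ι * ι = -1) :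
    ⁅eGen ι 0, eGen ι 1⁆ = single 2 (2, 2) + single 6 (4 * ι, -2 * ι) := by
  ext k <;> fin_cases k
  all_goals
    simp [lie_apply, eGen, single_apply, twist₁, twist₂, twist₄]
  all_goals grind

theorem ad_eGen_pow_two {ι : F} (hι : ι * ι = -1) :
    ⁅eGen ι 0, ⁅eGen ι 0, eGen ι 1⁆⁆ =
      single 4 (16, -8) + single 5 (-8 * ι, 16 * ι) := by
  simp only [lie_eGen_eGen hι]
  ext k <;> fin_cases k
  all_goals
    simp [lie_apply, eGen, single_apply, twist₁, twist₂, twist₄]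
  all_goals grind

theorem ad_eGen_pow_three {ι : F} (hι : ι * ι = -1) :
    ⁅eGen ι 0, ⁅eGen ι 0, ⁅eGen ι 0, eGen ι 1⁆⁆⁆ =
      single 2 (-48, 48) + single 6 (0, -48 * ι) := by
  simp only [ad_eGen_pow_two hι]
  ext k <;> fin_cases k
  all_goals
    simp [lie_apply, eGen, single_apply, twist₁, twist₂, twist₄]
  all_goals grind

theorem ad_eGen_zero_pow_four {ι : F} (hι : ι * ι = -1) :
    ⁅eGen ι 0, ⁅eGen ι 0, ⁅eGen ι 0, ⁅eGen ι 0, eGen ι 1⁆⁆⁆⁆ = 0 := by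
  simp only [ad_eGen_pow_three hι]
  ext k <;> fin_cases k
  all_goals
    simp [lie_apply, eGen, single_apply, twist₁, twist₂, twist₄]
  all_goals grind

theorem ad_eGen_one_pow_two {ι : F} (hι : ι * ι = -1) : ⁅eGen ι 1, ⁅eGen ι 1, eGen ι 0⁆⁆ = 0 := by
  rw [← lie_skew (eGen ι 1) (eGen ι 0), lie_neg, neg_eq_zero]
  simp only [lie_eGen_eGen hι]
  ext k <;> fin_cases k
  all_goals
    simp [lie_apply, eGen, single_apply, twist₁, twist₂, twist₄]
  all_goals grind

theorem lie_eGen_eGen_neg {ι : F} (hι : ι * ι = -1) (i j : Fin 2) :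
    ⁅eGen ι i, eGen (-ι) j⁆ = if i = j then (-4 : F) • hGen ι i else 0 := by
  fin_cases i <;> fin_cases j
  all_goals
    ext k <;> fin_cases k
  all_goals
    simp [lie_apply, eGen, hGen, single_apply, twist₁, twist₂, twist₄]
  all_goals grind

theorem serreRelations (h2 : (2 : F) ≠ 0) {ι : F} (hι : ι * ι = -1) :
    Matrix.SerreRelations F CartanMatrix.G₂ (eGen ι) (hGen ι) ((-1 / 4 : F) • eGen (-ι)) := by
  have h4 : (4 : F) ≠ 0 := by
    have := mul_ne_zero h2 h2
    norm_num at this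
    exact this
  have hι' : -ι * -ι = -1 := by rw [neg_mul_neg, hι]
  have ef (i j : Fin 2) : ⁅eGen ι i, (-1 / 4 : F) • eGen (-ι) j⁆ = if i = j then hGen ι i else 0 := by
    rw [lie_smul, lie_eGen_eGen_neg hι]
    split_ifs
    · rw [smul_smul]
      field_simp
      simp
    · simp
  refine .mk_G₂ ?_ (ef 0 0) (ef 1 1) (ef 0 1) (ef 1 0) (lie_hGen_eGen hι) (fun i j => ?_) (ad_eGen_zero_pow_four hι)
    (ad_eGen_one_pow_two hι) ?_ ?_
  · simp [hGen, lie_single_self]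
  · -- `h` changes sign with `ι`, which turns the relation for `e (-ι)` into the one for `f`.
    have := lie_hGen_eGen hι' i j
    rw [hGen_neg, Pi.neg_apply, neg_lie] at this
    rw [Pi.smul_apply, lie_smul, ← neg_neg ⁅hGen ι i, eGen (-ι) j⁆, this, smul_neg, smul_comm]
  · simp [ad_eGen_zero_pow_four hι']
  · simp [ad_eGen_one_pow_two hι']

/-- The generating property behind surjectivity: a subalgebra that contains the Cartan subalgebra
`S g₇`, one short vector at `1` and one long vector at `4` contains every `S g_i`. -/
theorem subalgebra_eq_top (h2 : (2 : F) ≠ 0) (h3 : (3 : F) ≠ 0)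
    (S : LieSubalgebra F (G2Model F)) (hs₀ : ∀ t, single 0 t ∈ S) (hs₁ : single 1 (1, -2) ∈ S)
    (hs₄ : single 4 (0, 1) ∈ S) : S = ⊤ := by
  have h₂ : single 2 (1, 1) ∈ S := by
    convert S.lie_mem hs₁ hs₄ using 1
    rw [show (4 : Fin 7) = 1 + 3 from rfl, lie_single_add_three]
    simp [twist₄]
    norm_num
  have h₄ (t) : single 4 t ∈ S := by
    have h := S.lie_mem hs₁ h₂
    rw [show (2 : Fin 7) = 1 + 1 from rfl, lie_single_add_one] at h
    have h4 : (4 : F) ≠ 0 := by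
      have := mul_ne_zero h2 h2
      norm_num at this
      exact this
    convert S.add_mem (S.smul_mem (t.1 / 4) h) (S.smul_mem (t.2 + 5 * t.1 / 4) hs₄) using 1
    rw [← map_smul, ← map_smul]
    change single 4 t = single 4 _ + single 4 _
    rw [← map_add]
    refine congrArg (single 4) ?_
    ext <;> simp [twist₁] <;> field_simp <;> ring
  have h₅ (t) : single 5 t ∈ S := by
    have h := S.lie_mem (hs₀ (1, 0)) (h₄ (-t.2, -t.1))
    rw [show (4 : Fin 7) = 0 + 4 from rfl, lie_single_add_four] at h
    simpa [twist₄] using h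
  have h₂' (t) : single 2 t ∈ S := by
    have h := S.lie_mem hs₁ (h₄ ((t.2 - t.1) / 3, (t.1 + 2 * t.2) / 3))
    rw [show (4 : Fin 7) = 1 + 3 from rfl, lie_single_add_three] at h
    convert h using 1
    simp only [Fin.reduceAdd]
    congr 1
    ext <;> simp [twist₄] <;> field_simp <;> ring
  have h₁ (t) : single 1 t ∈ S := by
    have h := S.lie_mem (h₂' (0, 1)) (h₄ (-t.1 - t.2, t.2))
    rw [show (4 : Fin 7) = 2 + 2 from rfl, lie_single_add_two] at h
    simpa [twist₂] using h
  have h₃ (t) : single 3 t ∈ S := by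
    have h := S.lie_mem (hs₀ (1, 0)) (h₁ (t.2, -t.1 - t.2))
    rw [show (1 : Fin 7) = 0 + 1 from rfl, lie_single_add_one] at h
    simpa [twist₁] using h
  have h₆ (t) : single 6 t ∈ S := by
    have h := S.lie_mem (hs₀ (0, 1)) (h₂' (-t.1 - t.2, t.2))
    rw [show (2 : Fin 7) = 0 + 2 from rfl, lie_single_add_two] at h
    simpa [twist₂] using h
  rw [eq_top_iff]
  intro u _
  rw [sum_single 0 u]
  exact add_mem (add_mem (add_mem (add_mem (add_mem (add_mem (hs₀ _) (h₁ _)) (h₂' _)) (h₃ _))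
    (h₄ _)) (h₅ _)) (h₆ _)

/-- The homomorphism from the Serre presentation is onto by `subalgebra_eq_top`, and injective because
the presented algebra has dimension at most `14`. -/
theorem nonempty_g₂_equiv (h2 : (2 : F) ≠ 0) (h3 : (3 : F) ≠ 0) {ι : F} (hι : ι * ι = -1) :
    Nonempty (LieAlgebra.g₂ F ≃ₗ⁅F⁆ G2Model F) := by
  obtain ⟨φ, hE, hH, hF⟩ := Matrix.ToLieAlgebra.exists_lift F (serreRelations h2 hι)
  have h4 : (4 : F) ≠ 0 := by
    have := mul_ne_zero h2 h2
    norm_num at this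
    exact this
  have e_mem (i) : eGen ι i ∈ φ.range := ⟨_, hE i⟩
  have e'_mem (i) : eGen (-ι) i ∈ φ.range := by
    have h : (-1 / 4 : F) • eGen (-ι) i ∈ φ.range := ⟨_, hF i⟩
    exact (Submodule.smul_mem_iff _ (div_ne_zero (neg_ne_zero.2 one_ne_zero) h4)).1 h
  have h_mem (i) : hGen ι i ∈ φ.range := ⟨_, hH i⟩
  have htop : φ.range = ⊤ := by
    refine subalgebra_eq_top h2 h3 _ (fun t => ?_) ?_ ?_
    · -- `h₀`, `h₁` are `-ι` times a basis of `S`; solve for `t` in that basis.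
      convert add_mem (φ.range.smul_mem (ι * (t.1 + t.2)) (h_mem 0))
        (φ.range.smul_mem (ι * (t.1 + 2 * t.2)) (h_mem 1)) using 1
      simp only [hGen, Matrix.cons_val_zero, Matrix.cons_val_one, ← map_smul, ← map_neg, ← map_add]
      congr 1
      ext <;> simp <;> grind
    · -- `e₀(ι) + e₀(-ι)` is twice the vector at `1`.
      refine (Submodule.smul_mem_iff φ.range.toSubmodule h2).1 ?_
      convert add_mem (e_mem 0) (e'_mem 0) using 1
      simp [eGen, two_smul]
    · refine (Submodule.smul_mem_iff φ.range.toSubmodule h2).1 ?_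
      convert add_mem (e_mem 1) (e'_mem 1) using 1
      simp [eGen, two_smul]
  have hsurj : Function.Surjective φ := φ.range_eq_top.1 htop
  have := LieAlgebra.g₂.finite F h2
  have hdim : Module.finrank F (LieAlgebra.g₂ F) = Module.finrank F (G2Model F) :=
    le_antisymm ((LieAlgebra.g₂.finrank_le F h2).trans_eq finrank_eq.symm)
      (LinearMap.finrank_le_finrank_of_surjective (f := (φ : LieAlgebra.g₂ F →ₗ[F] G2Model F)) hsurj)
  have hinj := (LinearMap.injective_iff_surjective_of_finrank_eq_finrank
    (f := (φ : LieAlgebra.g₂ F →ₗ[F] G2Model F)) hdim).2 hsurj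
  exact ⟨LieEquiv.ofBijective φ ⟨hinj, hsurj⟩⟩

/-! ### Extension of scalars -/

section BaseChange

variable (F) (E : Type*) [Field E] [Algebra F E]

instance : IsScalarTower F E (G2Model E) :=
  inferInstanceAs (IsScalarTower F E (Fin 7 → E × E))

/-- The map of models induced by the inclusion `F → E` on the coordinates. -/
def mapAlgebra : G2Model F →ₗ[F] G2Model E where
  toFun u k := (algebraMap F E (u k).1, algebraMap F E (u k).2)
  map_add' _ _ := funext fun _ => Prod.ext (map_add _ _ _) (map_add _ _ _)
  map_smul' _ _ := funext fun _ =>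
    Prod.ext ((map_mul _ _ _).trans (Algebra.smul_def _ _).symm)
      ((map_mul _ _ _).trans (Algebra.smul_def _ _).symm)

variable {F}

theorem mapAlgebra_apply (u : G2Model F) (k : Fin 7) :
    mapAlgebra F E u k = (algebraMap F E (u k).1, algebraMap F E (u k).2) := rfl

theorem mapAlgebra_lie (u v : G2Model F) :
    mapAlgebra F E ⁅u, v⁆ = ⁅mapAlgebra F E u, mapAlgebra F E v⁆ := by
  ext <;> simp [mapAlgebra_apply, lie_apply, twist₁, twist₂, twist₄]

theorem mapAlgebra_single (i : Fin 7) (t : F × F) :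
    mapAlgebra F E (single i t) = single i (algebraMap F E t.1, algebraMap F E t.2) := by
  ext k <;> by_cases h : k = i <;> simp [mapAlgebra_apply, single_apply, h]

theorem nonempty_baseChange_equiv {L : Type*} [LieRing L] [LieAlgebra F L]
    (ε : L ≃ₗ⁅F⁆ G2Model F) : Nonempty ((E ⊗[F] L) ≃ₗ⁅E⁆ G2Model E) := by
  let ψ : E ⊗[F] L →ₗ[E] G2Model E :=
    (mapAlgebra F E ∘ₗ (ε.toLinearEquiv : L →ₗ[F] G2Model F)).liftBaseChange E
  have hψ (c : E) (x : L) : ψ (c ⊗ₜ x) = c • mapAlgebra F E (ε x) := by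
    simp [ψ]
  let Ψ : E ⊗[F] L →ₗ⁅E⁆ G2Model E :=
    { ψ with
      map_lie' := by
        intro x y
        change ψ ⁅x, y⁆ = ⁅ψ x, ψ y⁆
        induction x with
        | zero => simp
        | add x x' hx hx' => simp [hx, hx']
        | tmul c x =>
          induction y with
          | zero => simp
          | add y y' hy hy' => simp [hy, hy']
          | tmul d y =>
            simp [hψ, LieEquiv.map_lie, mapAlgebra_lie, smul_smul, mul_comm] }
  have hsurj : Function.Surjective ψ := by
    rw [← LinearMap.range_eq_top, eq_top_iff]
    intro u _
    have key (i : Fin 7) (t : E × E) : single i t ∈ LinearMap.range ψ := by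
      refine ⟨t.1 ⊗ₜ ε.symm (single i (1, 0)) + t.2 ⊗ₜ ε.symm (single i (0, 1)), ?_⟩
      simp only [map_add, hψ, LieEquiv.apply_symm_apply, mapAlgebra_single]
      rw [← map_smul, ← map_smul, ← map_add]
      simp
    rw [sum_single 0 u]
    repeat first | exact key _ _ | refine add_mem ?_ (key _ _)
  have : Module.Finite F L := .equiv ε.toLinearEquiv.symm
  have hdim : Module.finrank E (E ⊗[F] L) = Module.finrank E (G2Model E) := by
    rw [Module.finrank_baseChange, ε.toLinearEquiv.finrank_eq, finrank_eq, finrank_eq]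
  have hinj := (LinearMap.injective_iff_surjective_of_finrank_eq_finrank (f := ψ) hdim).2 hsurj
  exact ⟨LieEquiv.ofBijective Ψ ⟨hinj, hsurj⟩⟩

end BaseChange

theorem isTypeG2_of_equiv (h2 : (2 : F) ≠ 0) (h3 : (3 : F) ≠ 0) {L : Type*} [LieRing L]
    [LieAlgebra F L] (ε : L ≃ₗ⁅F⁆ G2Model F) : IsTypeG2 F L := by
  obtain ⟨ι, hι⟩ := IsAlgClosed.exists_pow_nat_eq (-1 : AlgebraicClosure F) two_pos
  have hne {n : F} (hn : n ≠ 0) : algebraMap F (AlgebraicClosure F) n ≠ 0 := by simpa using hn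
  have h2' := hne h2
  have h3' := hne h3
  rw [map_ofNat] at h2' h3'
  obtain ⟨ε₁⟩ := nonempty_baseChange_equiv (AlgebraicClosure F) ε
  obtain ⟨ε₂⟩ := nonempty_g₂_equiv h2' h3' ((sq ι).symm.trans hι)
  exact ⟨ε₁.trans ε₂.symm⟩

end G2Model

/-! ### Direct sums with a central subspace -/

namespace LieAlgebra

variable {F A S M : Type*} [Field F] [LieRing A] [LieAlgebra F A] [AddCommGroup S] [Module F S]
  [LieRing M] [LieAlgebra F M]

theorem IsSimple.of_equiv [h : IsSimple F M] (ε : A ≃ₗ⁅F⁆ M) : IsSimple F A where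
  eq_bot_or_eq_top I := by
    have hmem (x : A) : x ∈ I ↔ ε x ∈ I.comap ε.symm.toLieHom := by
      simp [LieIdeal.mem_comap]
    refine (h.eq_bot_or_eq_top (I.comap ε.symm.toLieHom)).imp (fun hI => ?_) (fun hI => ?_)
    · ext x
      rw [hmem, hI]
      simp
    · ext x
      rw [hmem, hI]
      simp
  non_abelian hA := h.non_abelian ⟨fun x y => by
    have := hA.trivial (ε.symm x) (ε.symm y)
    rw [← LieEquiv.map_lie] at this
    simpa using this⟩

/-- If `e` identifies the bracket of `A` with that of `S × M`, where `S` is central, then `M` is an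
ideal of `A`. -/
def sndIdeal (e : A ≃ₗ[F] S × M) (he : ∀ x y, e ⁅x, y⁆ = (0, ⁅(e x).2, (e y).2⁆)) :
    LieIdeal F A where
  carrier := {x | (e x).1 = 0}
  add_mem' {x y} hx hy := by simp_all
  zero_mem' := by simp
  smul_mem' c x hx := by simp_all
  lie_mem {x y} _ := by simp [he]

theorem mem_sndIdeal {e : A ≃ₗ[F] S × M} {he : ∀ x y, e ⁅x, y⁆ = (0, ⁅(e x).2, (e y).2⁆)} {x : A} :
    x ∈ sndIdeal e he ↔ (e x).1 = 0 := Iff.rfl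

/-- The ideal `sndIdeal` is isomorphic to `M`. -/
noncomputable def sndIdealEquiv (e : A ≃ₗ[F] S × M)
    (he : ∀ x y, e ⁅x, y⁆ = (0, ⁅(e x).2, (e y).2⁆)) : sndIdeal e he ≃ₗ⁅F⁆ M where
  toFun x := (e x).2
  map_add' x y := by simp
  map_smul' c x := by simp
  map_lie' {x y} := by simp [he]
  invFun m := ⟨e.symm (0, m), by simp [mem_sndIdeal]⟩
  left_inv x := by
    ext
    have hx := mem_sndIdeal.1 x.2
    rw [← e.injective.eq_iff]
    ext <;> simp [hx]
  right_inv m := by simp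

theorem mem_center_iff_snd_eq_zero [hM : IsSimple F M] (e : A ≃ₗ[F] S × M)
    (he : ∀ x y, e ⁅x, y⁆ = (0, ⁅(e x).2, (e y).2⁆)) {x : A} : x ∈ center F A ↔ (e x).2 = 0 := by
  rw [LieModule.mem_maxTrivSubmodule]
  constructor
  · intro hx
    have hc : (e x).2 ∈ center F M := by
      rw [LieModule.mem_maxTrivSubmodule]
      intro m
      have h := congrArg e (hx (e.symm (0, m)))
      rw [he] at h
      simpa using h
    have : center F M = ⊥ := (hM.eq_bot_or_eq_top _).resolve_right fun h =>
      hM.non_abelian ((isLieAbelian_iff_center_eq_top F M).2 h)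
    simpa [this] using hc
  · intro hx y
    rw [← e.injective.eq_iff, he, hx]
    simp

theorem isCompl_center_sndIdeal [IsSimple F M] (e : A ≃ₗ[F] S × M)
    (he : ∀ x y, e ⁅x, y⁆ = (0, ⁅(e x).2, (e y).2⁆)) : IsCompl (center F A) (sndIdeal e he) := by
  rw [← LieSubmodule.isCompl_toSubmodule]
  constructor
  · refine Submodule.disjoint_def.2 fun x hx hx' => ?_
    rw [← e.map_eq_zero_iff]
    exact Prod.ext hx' ((mem_center_iff_snd_eq_zero e he).1 hx)
  · rw [codisjoint_iff, eq_top_iff]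
    intro x _
    have hx : x = e.symm ((e x).1, 0) + e.symm (0, (e x).2) := by
      rw [← map_add]
      simp
    rw [hx]
    refine Submodule.add_mem_sup ((mem_center_iff_snd_eq_zero e he).2 ?_) (mem_sndIdeal.2 ?_) <;>
      simp

theorem exists_isCompl_center {F A S M : Type*} [Field F] [iA : LieRing A] [iFA : LieAlgebra F A]
    [AddCommGroup S] [Module F S] [LieRing M] [LieAlgebra F M] [IsSimple F M]
    (e : A ≃ₗ[F] S × M) (he : ∀ x y, e ⁅x, y⁆ = (0, ⁅(e x).2, (e y).2⁆)) :
    (∀ x, x ∈ center F A ↔ (e x).2 = 0) ∧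
      ∃ K : LieIdeal F A, (∀ x, x ∈ K ↔ (e x).1 = 0) ∧ IsCompl (center F A) K ∧
        Nonempty (K ≃ₗ⁅F⁆ M) :=
  ⟨fun _ => mem_center_iff_snd_eq_zero e he, sndIdeal e he, fun _ => Iff.rfl,
    isCompl_center_sndIdeal e he, ⟨sndIdealEquiv e he⟩⟩

end LieAlgebra

/-! ### The twist and the coordinates of `S^σ[G]` -/

section Labels

/-- The element `g_i` of `ℤ₂³`, for `i` modulo 7. -/
def ofLabel : Fin 7 → Z23 :=
  ![(1, 0, 1), (1, 0, 0), (0, 1, 0), (0, 0, 1), (1, 1, 0), (0, 1, 1), (1, 1, 1)]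

theorem label_ofLabel (i : Fin 7) : label (ofLabel i) = some i := by decide +revert

theorem ofLabel_of_label {g : Z23} {i : Fin 7} (h : label g = some i) : ofLabel i = g := by
  decide +revert

theorem eq_zero_of_label {g : Z23} (h : label g = none) : g = 0 := by decide +revert

theorem label_zero : label 0 = none := by decide

theorem ofLabel_sub_add_one (i : Fin 7) : ofLabel i - ofLabel (i + 1) = ofLabel (i + 3) := by
  decide +revert

theorem ofLabel_sub_add_two (i : Fin 7) : ofLabel i - ofLabel (i + 2) = ofLabel (i + 6) := by
  decide +revert

theorem ofLabel_sub_add_three (i : Fin 7) : ofLabel i - ofLabel (i + 3) = ofLabel (i + 1) := by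
  decide +revert

theorem ofLabel_sub_add_four (i : Fin 7) : ofLabel i - ofLabel (i + 4) = ofLabel (i + 5) := by
  decide +revert

theorem ofLabel_sub_add_five (i : Fin 7) : ofLabel i - ofLabel (i + 5) = ofLabel (i + 4) := by
  decide +revert

theorem ofLabel_sub_add_six (i : Fin 7) : ofLabel i - ofLabel (i + 6) = ofLabel (i + 2) := by
  decide +revert

theorem univ_Z23 (k : Fin 7) : (Finset.univ : Finset Z23) =
    {0, ofLabel k, ofLabel (k + 1), ofLabel (k + 2), ofLabel (k + 3), ofLabel (k + 4),
      ofLabel (k + 5), ofLabel (k + 6)} := by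
  decide +revert

theorem sum_Z23 {M : Type*} [AddCommMonoid M] (k : Fin 7) (f : Z23 → M) :
    ∑ g, f g = f 0 + f (ofLabel k) + f (ofLabel (k + 1)) + f (ofLabel (k + 2)) +
      f (ofLabel (k + 3)) + f (ofLabel (k + 4)) + f (ofLabel (k + 5)) + f (ofLabel (k + 6)) := by
  rw [univ_Z23 k]
  repeat rw [Finset.sum_insert (by decide +revert)]
  simp only [Finset.sum_singleton, add_assoc]

end Labels

section Twist

variable (F : Type*) [Field F]

theorem so7Twist_zero_left (h : Z23) : so7Twist F 0 h = 0 := by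
  simp [so7Twist, label_zero]

theorem so7Twist_zero_right (g : Z23) : so7Twist F g 0 = 0 := by
  cases hg : label g <;> simp [so7Twist, label_zero, hg]

theorem so7Twist_self (g : Z23) : so7Twist F g g = 0 := by
  cases hg : label g <;> simp [so7Twist, hg]

theorem so7Twist_ofLabel (i n : Fin 7) : so7Twist F (ofLabel i) (ofLabel (i + n)) =
    match n with
    | 0 => 0
    | 1 => so7Twist₁ F
    | 2 => so7Twist₂ F
    | 3 => -(so7Twist₄ F).flip
    | 4 => so7Twist₄ F
    | 5 => -(so7Twist₂ F).flip
    | 6 => -(so7Twist₁ F).flip := by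
  fin_cases n <;> simp [so7Twist, label_ofLabel]

variable {F}

theorem mem_planeS {a : Fin 3 → F} : a ∈ planeS F ↔ a 0 + a 1 + a 2 = 0 := Iff.rfl

theorem so7Twist₁_mem {r s : Fin 3 → F} (hr : r ∈ planeS F) (hs : s ∈ planeS F) :
    so7Twist₁ F r s ∈ planeS F := by
  rw [mem_planeS] at *
  simp only [so7Twist₁, LinearMap.mk₂_apply, Matrix.cons_val]
  linear_combination s 1 * hr - (r 1 + r 2) * hs

theorem so7Twist₂_mem {r s : Fin 3 → F} (hr : r ∈ planeS F) (hs : s ∈ planeS F) :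
    so7Twist₂ F r s ∈ planeS F := by
  rw [mem_planeS] at *
  simp only [so7Twist₂, LinearMap.mk₂_apply, Matrix.cons_val]
  linear_combination -(s 0 + s 1) * hr + r 1 * hs

theorem so7Twist₄_mem {r s : Fin 3 → F} (hr : r ∈ planeS F) (hs : s ∈ planeS F) :
    so7Twist₄ F r s ∈ planeS F := by
  rw [mem_planeS] at *
  simp only [so7Twist₄, LinearMap.mk₂_apply, Matrix.cons_val]
  linear_combination s 0 * hr - (r 0 + r 1) * hs

theorem so7Twist_mem (g h : Z23) {r s : Fin 3 → F} (hr : r ∈ planeS F) (hs : s ∈ planeS F) :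
    so7Twist F g h r s ∈ planeS F := by
  unfold so7Twist
  split
  · split
    · exact zero_mem _
    · exact so7Twist₁_mem hr hs
    · exact so7Twist₂_mem hr hs
    · exact neg_mem (so7Twist₄_mem hs hr)
    · exact so7Twist₄_mem hr hs
    · exact neg_mem (so7Twist₂_mem hs hr)
    · exact neg_mem (so7Twist₁_mem hs hr)
  · exact zero_mem _

/-- The coordinates `(a₁, a₂)` on the plane `S`. -/
def planeSEquiv : planeS F ≃ₗ[F] F × F where
  toFun s := (s.1 0, s.1 1)
  map_add' s t := rfl
  map_smul' c s := rfl
  invFun t := ⟨![t.1, t.2, -t.1 - t.2], by simp [mem_planeS]⟩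
  left_inv s := by
    ext k
    have := mem_planeS.1 s.2
    fin_cases k <;> simp
    linear_combination -this
  right_inv t := rfl

theorem planeSEquiv_apply (s : planeS F) : planeSEquiv s = (s.1 0, s.1 1) := rfl

end Twist

namespace GenGroupAlg

section Coeff

variable {F G V : Type*} [Field F] [AddCommGroup V] [Module F V]
  (σ : G → G → V →ₗ[F] V →ₗ[F] V)

theorem coeff_mono_self (g : G) (r : V) : coeff σ g (mono σ g r) = r :=
  Finsupp.single_eq_same

theorem coeff_mono_of_ne {g h : G} (hg : h ≠ g) (r : V) : coeff σ h (mono σ g r) = 0 :=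
  Finsupp.single_eq_of_ne hg

theorem prod_apply [AddCommGroup G] [Fintype G] (x y : G →₀ V) (k : G) :
    prod σ x y k = ∑ g, σ g (k - g) (x g) (y (k - g)) := by
  classical
  rw [prod, Finsupp.sum_fintype _ _ (by simp), Finsupp.finsetSum_apply]
  refine Finset.sum_congr rfl fun g _ => ?_
  rw [Finsupp.sum_fintype _ _ (by simp), Finsupp.finsetSum_apply,
    Finset.sum_eq_single_of_mem (k - g) (Finset.mem_univ _) fun h _ hh => ?_]
  · rw [add_sub_cancel, Finsupp.single_eq_same]
  · refine Finsupp.single_eq_of_ne fun hk => hh ?_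
    rw [hk, add_sub_cancel_left]

theorem coeff_mul [AddCommGroup G] [Fintype G] (x y : GenGroupAlg σ) (k : G) :
    coeff σ k (x * y) = ∑ g, σ g (k - g) (coeff σ g x) (coeff σ (k - g) y) :=
  prod_apply σ x y k

end Coeff

end GenGroupAlg

section Decomposition

open GenGroupAlg G2Model

variable (F : Type*) [Field F]

/-- The twist `σ` restricted to the plane `S`. -/
abbrev planeTwist : Z23 → Z23 → planeS F →ₗ[F] planeS F →ₗ[F] planeS F :=
  restrictTwist (so7Twist F) (planeS F) fun g h _ hr _ hs => so7Twist_mem g h hr hs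

variable {F}

theorem coe_planeTwist (g h : Z23) (r s : planeS F) :
    (planeTwist F g h r s : Fin 3 → F) = so7Twist F g h r s := rfl

theorem planeTwist_self (g : Z23) : planeTwist F g g = 0 := by
  ext r s : 3
  simp [coe_planeTwist, so7Twist_self]

theorem planeTwist_zero_left (g : Z23) : planeTwist F 0 g = 0 := by
  ext r s : 3
  simp [coe_planeTwist, so7Twist_zero_left]

theorem planeTwist_zero_right (g : Z23) : planeTwist F g 0 = 0 := by
  ext r s : 3
  simp [coe_planeTwist, so7Twist_zero_right]

theorem planeSEquiv_planeTwist (i n : Fin 7) (r s : planeS F) :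
    planeSEquiv (planeTwist F (ofLabel i) (ofLabel (i + n)) r s) =
      match n with
      | 0 => 0
      | 1 => twist₁ (planeSEquiv r) (planeSEquiv s)
      | 2 => twist₂ (planeSEquiv r) (planeSEquiv s)
      | 3 => -twist₄ (planeSEquiv s) (planeSEquiv r)
      | 4 => twist₄ (planeSEquiv r) (planeSEquiv s)
      | 5 => -twist₂ (planeSEquiv s) (planeSEquiv r)
      | 6 => -twist₁ (planeSEquiv s) (planeSEquiv r) := by
  have hr : r.1 2 = -r.1 0 - r.1 1 := by linear_combination mem_planeS.1 r.2
  have hs : s.1 2 = -s.1 0 - s.1 1 := by linear_combination mem_planeS.1 s.2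
  fin_cases n <;> ext <;>
    simp [-mul_eq_mul_right_iff, planeSEquiv_apply, coe_planeTwist, so7Twist_self,
      so7Twist_ofLabel, so7Twist₁, so7Twist₂, so7Twist₄, twist₁, twist₂, twist₄, hr, hs] <;> ring

/-- The decomposition `S^σ[G] = S g₀ ⊕ S^σ[G^×]`, with the second summand in coordinates. -/
noncomputable def decomposition : GenGroupAlg (planeTwist F) ≃ₗ[F] planeS F × G2Model F where
  toFun x := (coeff _ 0 x, fun i => planeSEquiv (coeff _ (ofLabel i) x))
  map_add' x y := by
    refine Prod.ext (map_add _ _ _) (funext fun i => ?_)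
    exact (congrArg _ (map_add _ _ _)).trans (map_add _ _ _)
  map_smul' c x := by
    refine Prod.ext (map_smul _ _ _) (funext fun i => ?_)
    exact (congrArg _ (map_smul _ _ _)).trans (map_smul _ _ _)
  invFun p := Finsupp.equivFunOnFinite.symm fun g =>
    match label g with
    | none => p.1
    | some i => planeSEquiv.symm (p.2 i)
  left_inv x := by
    refine Finsupp.ext fun g => ?_
    cases hg : label g with
    | none =>
      rw [eq_zero_of_label hg]
      rfl
    | some i =>
      rw [← ofLabel_of_label hg]
      simp [label_ofLabel]
      rfl
  right_inv p := by
    refine Prod.ext rfl (funext fun i => ?_)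
    change planeSEquiv (match label (ofLabel i) with
      | none => p.1
      | some i => planeSEquiv.symm (p.2 i)) = p.2 i
    rw [label_ofLabel]
    exact planeSEquiv.apply_symm_apply _

theorem decomposition_fst (x : GenGroupAlg (planeTwist F)) : (decomposition x).1 = coeff _ 0 x :=
  rfl

theorem decomposition_snd (x : GenGroupAlg (planeTwist F)) (i : Fin 7) :
    (decomposition x).2 i = planeSEquiv (coeff _ (ofLabel i) x) := rfl

/-- The product of `S^σ[G]` has no component at `g₀`, as `σ_{g,g} = 0` and `-g = g`, does not depend on
the components at `g₀`, and is the bracket of the model on the rest. -/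
theorem decomposition_mul (x y : GenGroupAlg (planeTwist F)) :
    decomposition (x * y) = (0, ⁅(decomposition x).2, (decomposition y).2⁆) := by
  refine Prod.ext ?_ (G2Model.ext fun k => ?_)
  · rw [decomposition_fst, coeff_mul]
    refine Finset.sum_eq_zero fun g _ => ?_
    rw [show (0 : Z23) - g = g by decide +revert, planeTwist_self]
    rfl
  · have h₁ := planeSEquiv_planeTwist (F := F) (k + 4) 1
    have h₂ := planeSEquiv_planeTwist (F := F) (k + 1) 2
    have h₃ := planeSEquiv_planeTwist (F := F) (k + 6) 3
    have h₄ := planeSEquiv_planeTwist (F := F) (k + 2) 4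
    have h₅ := planeSEquiv_planeTwist (F := F) (k + 3) 5
    have h₆ := planeSEquiv_planeTwist (F := F) (k + 5) 6
    simp only [add_assoc, Fin.reduceAdd] at h₁ h₂ h₃ h₄ h₅ h₆
    change _ = ⁅(decomposition x).2, (decomposition y).2⁆ k
    rw [decomposition_snd, coeff_mul, sum_Z23 k, lie_apply]
    simp only [decomposition_snd, map_add, sub_self, ofLabel_sub_add_one, ofLabel_sub_add_two,
      ofLabel_sub_add_three, ofLabel_sub_add_four, ofLabel_sub_add_five, ofLabel_sub_add_six,
      planeTwist_zero_left, planeTwist_zero_right, h₁, h₂, h₃, h₄, h₅, h₆, LinearMap.zero_apply,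
      map_zero]
    abel

theorem isLie_planeTwist : IsLie (planeTwist F) where
  mul_self x := by
    rw [← decomposition.map_eq_zero_iff, decomposition_mul, lie_self]
    rfl
  jacobi x y z := by
    rw [← decomposition.map_eq_zero_iff]
    simp only [map_add, decomposition_mul]
    refine Prod.ext (by simp) ?_
    have h := lie_jacobi (decomposition x).2 (decomposition y).2 (decomposition z).2
    rw [← lie_skew _ ⁅_, _⁆, ← lie_skew _ ⁅(decomposition z).2, _⁆,
      ← lie_skew _ ⁅(decomposition x).2, _⁆, ← neg_add, ← neg_add, neg_eq_zero] at h
    refine Eq.trans ?_ h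
    simp only [Prod.snd_add]
    abel

theorem mem_component_zero_iff {x : GenGroupAlg (planeTwist F)} :
    x ∈ component (planeTwist F) 0 ↔ (decomposition x).2 = 0 := by
  have hmono (r : planeS F) : decomposition (mono _ 0 r) = (r, 0) := by
    refine Prod.ext (coeff_mono_self _ _ _) (G2Model.ext fun i => ?_)
    have h0 : ofLabel i ≠ 0 := by decide +revert
    rw [decomposition_snd, coeff_mono_of_ne _ h0, map_zero]
    rfl
  constructor
  · rintro ⟨r, rfl⟩
    rw [hmono]
  · intro hx
    refine ⟨(decomposition x).1, decomposition.injective ?_⟩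
    rw [hmono]
    exact Prod.ext rfl hx.symm

theorem finrank_component_zero : Module.finrank F (component (planeTwist F) 0) = 2 := by
  rw [component, LinearMap.finrank_range_of_inj, planeSEquiv.finrank_eq, Module.finrank_prod,
    Module.finrank_self]
  exact Function.LeftInverse.injective (coeff_mono_self _ 0)

end Decomposition

/-! ### The Lie algebra `S^σ[G]` -/

theorem proposition2p4 {F : Type*} [Field F] :
    ∃ hS : ∀ g h : Z23, ∀ r ∈ planeS F, ∀ s ∈ planeS F, so7Twist F g h r s ∈ planeS F,
    ∃ hL : GenGroupAlg.IsLie (GenGroupAlg.restrictTwist (so7Twist F) (planeS F) hS),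
      (2 : F) ≠ 0 → (3 : F) ≠ 0 →
      letI A := GenGroupAlg (GenGroupAlg.restrictTwist (so7Twist F) (planeS F) hS)
      letI : LieRing A := hL.lieRing
      letI : LieAlgebra F A := hL.lieAlgebra
      (LieAlgebra.center F A).toSubmodule =
          GenGroupAlg.component (GenGroupAlg.restrictTwist (so7Twist F) (planeS F) hS) 0 ∧
        Module.finrank F (LieAlgebra.center F A) = 2 ∧
        ∃ K : LieIdeal F A,
          (∀ x : A, x ∈ K ↔
            GenGroupAlg.coeff (GenGroupAlg.restrictTwist (so7Twist F) (planeS F) hS) 0 x = 0) ∧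
          IsCompl (LieAlgebra.center F A) K ∧
          Module.finrank F K = 14 ∧
          LieAlgebra.IsSimple F K ∧
          IsTypeG2 F K := by
  refine ⟨fun g h _ hr _ hs => so7Twist_mem g h hr hs, isLie_planeTwist, fun h2 h3 => ?_⟩
  let : LieRing (GenGroupAlg (planeTwist F)) := isLie_planeTwist.lieRing
  let : LieAlgebra F (GenGroupAlg (planeTwist F)) := isLie_planeTwist.lieAlgebra
  have := G2Model.isSimple h2 h3
  obtain ⟨hcenter, K, hK, hcompl, ⟨ε⟩⟩ := LieAlgebra.exists_isCompl_center
    (iA := isLie_planeTwist.lieRing) (iFA := isLie_planeTwist.lieAlgebra)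
    (decomposition (F := F)) decomposition_mul
  have hcenter' : (LieAlgebra.center F (GenGroupAlg (planeTwist F))).toSubmodule =
      GenGroupAlg.component (planeTwist F) 0 := by
    ext x
    exact (hcenter x).trans mem_component_zero_iff.symm
  have hfinrank : Module.finrank F (LieAlgebra.center F (GenGroupAlg (planeTwist F))) = 2 :=
    (congrArg (fun N : Submodule F _ => Module.finrank F N) hcenter').trans finrank_component_zero
  exact ⟨hcenter', hfinrank, K, hK, hcompl, ε.toLinearEquiv.finrank_eq.trans G2Model.finrank_eq,
    .of_equiv ε, G2Model.isTypeG2_of_equiv h2 h3 ε⟩
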